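/- Let $K$ be a field that is complete with respect to a non-Archimedean absolute value (possibly trivial), with valuation ring $R=\{a\in K : |a|\le 1\}$. Let $k=K$ or $k=R$ and let $Y$ be a scheme of finite type over $k$. **Toric prevarieties.** A toric prevariety over $k$ is a scheme $X=X(S)_k$ obtained from a system of fans $S=(\Delta_{ij})_{i,j\in I}$ ($I$ finite and non-empty, all $\Delta_{ij}$ non-empty fans of strongly convex rational polyhedral cones in $N_{\mathbb R}$ for one lattice $N$ with dual lattice $M$, $\Delta_{ij}=\Delta_{ji}$, $\Delta_{ij}\cap\Delta_{jk}\subseteq\Delta_{ik}$) by gluing the affine charts $U_{[\sigma,i]}=\operatorname{Spec}k[S_\sigma]$, $S_\sigma=\sigma^\vee\cap M$, $\sigma\in\Delta_{ii}$, where $[\sigma,i]=[\sigma,j]$ if $\sigma\in\Delta_{ij}$, along the faces. Let $\Omega(S)$ be the set of classes $[\sigma,i]$, ordered by $[\tau,i]\preceq[\sigma,i]$ if $\tau$ is a face of $\sigma$. A toric morphism is one induced by a homomorphism $F\colon N\to N'$ and an order-preserving map $\mathfrak f\colon\Omega(S)\to\Omega(S')$ with $F_{\mathbb R}(\sigma)\subseteq\sigma'$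 whenever $\mathfrak f[\sigma,i]=[\sigma',i']$. **Tropicalization.** For a $K$-scheme let $(\cdot)^{an}$ be the topological space underlying its Berkovich analytification. For an $R$-scheme let $(\cdot)^\circ$ be the topological space underlying its Raynaud generic fiber, i.e. the colimit over the affine opens $\operatorname{Spec}A$ of the spaces of multiplicative seminorms on $A$ that extend the absolute value of $R$ and are bounded by $1$. Let $\overline{\mathbb R}=\mathbb R\cup\{\infty\}$, and let $X^{trop}$ (resp. $X^{trop,\ge0}$) be the colimit of the spaces $\operatorname{Hom}(S_\sigma,\overline{\mathbb R})$ (resp. $\operatorname{Hom}(S_\sigma,\overline{\mathbb R}_{\ge0})$) over $[\sigma,i]\in\Omega(S)$. The continuous map $\operatorname{trop}_X\colon X^{an}\to X^{trop}$ (resp. $\operatorname{trop}_X^{\ge0}\colon X^\circ\to X^{trop,\ge0}$) is given on charts by $x\mapsto(s\mapsto-\log|\chi^s|_x)$. For a locally closed embedding $i\colon Y\to X$ of $k$-schemes into a toric prevariety, $\operatorname{Trop}(Y,i)\subseteq X^{trop}$ (resp. $\operatorname{Trop}^{\ge0}(Y,i)\subseteq X^{trop,\ge0}$) is the image of $\operatorname{trop}_i=\operatorname{trop}_X\circ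 i^{an}$ (resp. $\operatorname{trop}^{\ge0}_i=\operatorname{trop}^{\ge0}_X\circ i^\circ$), with the subspace topology. **Systems of embeddings.** Let $\mathcal I$ be a non-empty system of locally closed embeddings of $Y$ into toric prevarieties over $k$, i.e. a family of embeddings $i\colon Y\to X_i$ together with a collection of toric morphisms $f\colon X_{i'}\to X_i$ such that $f\circ i'=i$. Assume that $\mathcal I$ is closed under finite products (for $i,i'\in\mathcal I$, the product embedding $Y\to X_i\times_kX_{i'}$ and both projections belong to $\mathcal I$) and that: * $(+)$ for every point $y\in Y$ there are $i\in\mathcal I$ and a torus-invariant affine open $U\subseteq X_i$ with $i(y)\in U$ such that $i^{-1}(U)\to U$ is a closed embedding; * $(\ast)$ there is a finite affine open cover $Y=V_1\cup\dots\cup V_r$ such that for every $l$ and every $f\in\mathcal O_Y(V_l)$ there are $i\in\mathcal I$ and a torus-invariant open $U\subseteq X_i$ such that $V_l=i^{-1}(U)$ and $f$ is the pullback of a monomial on $U$, i.e. of a regular function on $U$ that is of the form $a\chi^m$ with $m\in M$, $0\neq a\in k$ on the big torus. Then, if $k=K$, the maps $\operatorname{trop}_i$ induce a homeomorphism $$\pi_{\mathcal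 I}\colon Y^{an}\longrightarrow\varprojlim_{i\in\mathcal I}\operatorname{Trop}(Y,i),$$ and, if $k=R$, the maps $\operatorname{trop}_i^{\ge0}$ induce a homeomorphism $$\pi_{\mathcal I}\colon Y^\circ\longrightarrow\varprojlim_{i\in\mathcal I}\operatorname{Trop}^{\ge0}(Y,i).$$ -/

import Mathlib

open CategoryTheory CategoryTheory.Limits AlgebraicGeometry

universe u w

namespace ToricTrop

/-! ### Cones, fans and systems of fans -/

/-- Convex cones in `N_ℝ = ℝⁿ`, where `N = ℤⁿ`. -/
abbrev Cone (n : ℕ) := PointedCone ℝ (Fin n → ℝ)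

/-- The pairing of `m ∈ M = ℤⁿ` (the dual lattice of `N = ℤⁿ`) with `v ∈ N_ℝ`. -/
def pairing {n : ℕ} (m : Fin n → ℤ) (v : Fin n → ℝ) : ℝ := ∑ j, (m j : ℝ) * v j

section pairing
variable {n : ℕ}

lemma pairing_zero_left (v : Fin n → ℝ) : pairing 0 v = 0 := by simp [pairing]

lemma pairing_add_left (m m' : Fin n → ℤ) (v : Fin n → ℝ) :
    pairing (m + m') v = pairing m v + pairing m' v := by
  simp [pairing, add_mul, Finset.sum_add_distrib]

lemma pairing_neg_left (m : Fin n → ℤ) (v : Fin n → ℝ) :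
    pairing (-m) v = - pairing m v := by
  simp [pairing]

lemma pairing_nsmul_left (p : ℕ) (m : Fin n → ℤ) (v : Fin n → ℝ) :
    pairing (p • m) v = p * pairing m v := by
  simp [pairing, Finset.mul_sum, mul_assoc]

lemma pairing_zero_right (m : Fin n → ℤ) : pairing m 0 = 0 := by simp [pairing]

lemma pairing_add_right (m : Fin n → ℤ) (v v' : Fin n → ℝ) :
    pairing m (v + v') = pairing m v + pairing m v' := by
  simp [pairing, mul_add, Finset.sum_add_distrib]

lemma pairing_smul_right (m : Fin n → ℤ) (c : ℝ) (v : Fin n → ℝ) :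
    pairing m (c • v) = c * pairing m v := by
  simp [pairing, Finset.mul_sum, mul_left_comm]

end pairing

/-- The monoid `S_σ = σ^∨ ∩ M` of lattice points in the dual cone. -/
def dualMonoid {n : ℕ} (σ : Cone n) : AddSubmonoid (Fin n → ℤ) where
  carrier := {m | ∀ v ∈ σ, 0 ≤ pairing m v}
  zero_mem' := fun v _ => (pairing_zero_left v).ge
  add_mem' := fun ha hb v hv => by
    rw [pairing_add_left]; exact add_nonneg (ha v hv) (hb v hv)

lemma dualMonoid_anti {n : ℕ} {σ τ : Cone n} (h : τ ≤ σ) : dualMonoid σ ≤ dualMonoid τ :=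
  fun _ hm v hv => hm v (h hv)

/-- The face `σ ∩ m^⊥` of `σ` cut out by `m ∈ S_σ`. -/
def faceOf {n : ℕ} (σ : Cone n) (m : Fin n → ℤ) : Cone n where
  carrier := {v | v ∈ σ ∧ pairing m v = 0}
  zero_mem' := ⟨zero_mem _, pairing_zero_right m⟩
  add_mem' := fun ha hb => ⟨add_mem ha.1 hb.1, by rw [pairing_add_right, ha.2, hb.2, add_zero]⟩
  smul_mem' := fun c v hv => ⟨Submodule.smul_mem σ c hv.1, by
    have := pairing_smul_right m (c : ℝ) v
    rw [hv.2, mul_zero] at this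
    exact this⟩

/-- `τ` is a face of the (rational polyhedral) cone `σ`. -/
def IsFace {n : ℕ} (τ σ : Cone n) : Prop := ∃ m ∈ dualMonoid σ, τ = faceOf σ m

/-- `σ` is a rational polyhedral cone: it is generated by finitely many lattice vectors. -/
def IsRationalPolyhedral {n : ℕ} (σ : Cone n) : Prop :=
  ∃ s : Finset (Fin n → ℤ), σ = PointedCone.hull ℝ ((fun w j => (w j : ℝ)) '' (s : Set (Fin n → ℤ)))

lemma IsFace.le {n : ℕ} {τ σ : Cone n} (h : IsFace τ σ) : τ ≤ σ := by
  obtain ⟨m, -, rfl⟩ := h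
  exact fun v hv => hv.1

lemma IsFace.refl {n : ℕ} (σ : Cone n) : IsFace σ σ :=
  ⟨0, zero_mem _, le_antisymm (fun v hv => ⟨hv, pairing_zero_left v⟩) (fun _ hv => hv.1)⟩

/-- A (rational polyhedral) fan in `N_ℝ = ℝⁿ`. -/
structure Fan (n : ℕ) where
  cones : Set (Cone n)
  finite : cones.Finite
  nonempty : cones.Nonempty
  rational : ∀ σ ∈ cones, IsRationalPolyhedral σ
  stronglyConvex : ∀ σ ∈ cones, ∀ v ∈ σ, -v ∈ σ → v = 0
  face_mem : ∀ σ ∈ cones, ∀ τ, IsFace τ σ → τ ∈ cones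
  inter_face : ∀ σ ∈ cones, ∀ τ ∈ cones, IsFace (σ ⊓ τ) σ

/-- A system of fans `S = (Δ_ij)_{i,j ∈ I}` in the lattice `N = ℤ^rank`. -/
structure SystemOfFans where
  rank : ℕ
  I : Type
  [finite : Finite I]
  [nonempty : Nonempty I]
  fan : I → I → Fan rank
  symm : ∀ i j, fan i j = fan j i
  trans : ∀ i j k, (fan i j).cones ∩ (fan j k).cones ⊆ (fan i k).cones

namespace SystemOfFans
variable (S : SystemOfFans)

lemma mem_left {i j : S.I} {σ : Cone S.rank} (h : σ ∈ (S.fan i j).cones) :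
    σ ∈ (S.fan i i).cones :=
  S.trans i j i ⟨h, by rwa [S.symm j i]⟩

/-- The pairs `(σ, i)` with `σ ∈ Δ_ii`. -/
def Pair := {p : Cone S.rank × S.I // p.1 ∈ (S.fan p.2 p.2).cones}

/-- `(σ, i)` and `(τ, j)` are equivalent if `σ = τ ∈ Δ_ij`. -/
instance pairSetoid : Setoid S.Pair where
  r p q := p.1.1 = q.1.1 ∧ p.1.1 ∈ (S.fan p.1.2 q.1.2).cones
  iseqv :=
    { refl := fun p => ⟨rfl, p.2⟩
      symm := fun {p q} h => ⟨h.1.symm, by rw [S.symm, ← h.1]; exact h.2⟩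
      trans := fun {p q r} h h' => ⟨h.1.trans h'.1,
        S.trans _ _ _ ⟨h.2, by rw [h.1]; exact h'.2⟩⟩ }

/-- The set `Ω(S)` of classes `[σ, i]`. -/
def Omega := Quotient S.pairSetoid

variable {S}

/-- The class `[σ, i]`. -/
def cls (σ : Cone S.rank) (i : S.I) (h : σ ∈ (S.fan i i).cones) : S.Omega :=
  Quotient.mk _ ⟨(σ, i), h⟩

lemma cls_eq_cls {σ τ : Cone S.rank} {i j : S.I} {h : σ ∈ (S.fan i i).cones}
    {h' : τ ∈ (S.fan j j).cones} :
    cls σ i h = cls τ j h' ↔ σ = τ ∧ σ ∈ (S.fan i j).cones :=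
  Quotient.eq

/-- The cone `σ` of a class `[σ, i]`. -/
def Omega.cone (ω : S.Omega) : Cone S.rank :=
  Quotient.lift (fun p : S.Pair => p.1.1) (fun p q h => (show p.1.1 = q.1.1 ∧ _ from h).1) ω

@[simp] lemma cone_cls (σ : Cone S.rank) (i : S.I) (h : σ ∈ (S.fan i i).cones) :
    (cls σ i h).cone = σ := rfl

/-- `[τ, j] ≼ [σ, i]` if `τ` is a face of `σ` and `[τ, j] = [τ, i]`. -/
instance : Preorder S.Omega where
  le a b := ∃ (i : S.I) (τ σ : Cone S.rank) (hτ : τ ∈ (S.fan i i).cones)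
    (hσ : σ ∈ (S.fan i i).cones), a = cls τ i hτ ∧ b = cls σ i hσ ∧ IsFace τ σ
  le_refl a := by
    induction a using Quotient.inductionOn with
    | h p => exact ⟨p.1.2, p.1.1, p.1.1, p.2, p.2, rfl, rfl, .refl _⟩
  le_trans a b c := by
    rintro ⟨i, ρ, τ, hρ, hτ, rfl, rfl, h⟩ ⟨j, τ', σ, hτ', hσ, e, rfl, h'⟩
    obtain ⟨rfl, hij⟩ := cls_eq_cls.1 e
    have hρij := (S.fan i j).face_mem _ hij _ h
    have hρj : ρ ∈ (S.fan j j).cones := S.mem_left (by rwa [S.symm j i])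
    refine ⟨j, ρ, σ, hρj, hσ, cls_eq_cls.2 ⟨rfl, hρij⟩, rfl, ?_⟩
    have := (S.fan j j).inter_face σ hσ ρ hρj
    rwa [inf_eq_right.2 (h.le.trans h'.le)] at this

lemma le_iff {a b : S.Omega} : a ≤ b ↔ ∃ (i : S.I) (τ σ : Cone S.rank)
    (hτ : τ ∈ (S.fan i i).cones) (hσ : σ ∈ (S.fan i i).cones),
    a = cls τ i hτ ∧ b = cls σ i hσ ∧ IsFace τ σ := Iff.rfl

lemma Omega.isFace {a b : S.Omega} (h : a ≤ b) : IsFace a.cone b.cone := by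
  obtain ⟨i, τ, σ, hτ, hσ, rfl, rfl, h⟩ := h
  exact h

lemma Omega.rational (a : S.Omega) : IsRationalPolyhedral a.cone := by
  induction a using Quotient.inductionOn with
  | h p => exact (S.fan _ _).rational _ p.2

end SystemOfFans

/-! ### Toric prevarieties -/

section charts
variable (k : Type u) [CommRing k] {n : ℕ}

/-- The ring homomorphism `k[S_σ] → k[S_τ]` for `τ ⊆ σ`. -/
noncomputable def chartRingHom {σ τ : Cone n} (h : τ ≤ σ) :
    AddMonoidAlgebra k (dualMonoid σ) →+* AddMonoidAlgebra k (dualMonoid τ) :=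
  AddMonoidAlgebra.mapDomainRingHom k (AddSubmonoid.inclusion (dualMonoid_anti h))

/-- The element `χ^m` of `k[S_σ]`. -/
noncomputable def chi {σ : Cone n} (m : dualMonoid σ) : AddMonoidAlgebra k (dualMonoid σ) :=
  AddMonoidAlgebra.single m 1

/-- Some multiple of `m` added to `w ∈ S_τ` lies in `S_σ`, for the face `τ = σ ∩ m^⊥`. -/
lemma exists_add_nsmul_mem {σ : Cone n} (hσ : IsRationalPolyhedral σ) {m : Fin n → ℤ}
    (hm : m ∈ dualMonoid σ) {w : Fin n → ℤ} (hw : w ∈ dualMonoid (faceOf σ m)) :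
    ∃ p : ℕ, w + p • m ∈ dualMonoid σ := by
  obtain ⟨s, rfl⟩ := hσ
  have key : ∀ v : Fin n → ℤ, v ∈ s → ∃ p : ℕ, ∀ q : ℕ, p ≤ q →
      0 ≤ pairing (w + q • m) (fun j => (v j : ℝ)) := by
    intro v hv
    have hvσ : (fun j => (v j : ℝ)) ∈
        PointedCone.hull ℝ ((fun w j => (w j : ℝ)) '' (s : Set (Fin n → ℤ))) :=
      PointedCone.subset_hull ⟨v, hv, rfl⟩
    have h0 := hm _ hvσ
    rcases h0.eq_or_lt with h0 | h0
    · refine ⟨0, fun q _ => ?_⟩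
      rw [pairing_add_left, pairing_nsmul_left, ← h0, mul_zero, add_zero]
      exact hw _ ⟨hvσ, h0.symm⟩
    · obtain ⟨p, hp⟩ := exists_nat_ge (-pairing w (fun j => (v j : ℝ)) /
        pairing m (fun j => (v j : ℝ)))
      refine ⟨p, fun q hq => ?_⟩
      rw [pairing_add_left, pairing_nsmul_left]
      rw [div_le_iff₀ h0] at hp
      have : (p : ℝ) * pairing m (fun j => (v j : ℝ)) ≤ q * pairing m (fun j => (v j : ℝ)) := by
        gcongr
      linarith
  choose! p hp using key
  refine ⟨s.sup p, fun v hv => ?_⟩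
  induction hv using Submodule.span_induction with
  | mem x hx =>
    obtain ⟨v, hv, rfl⟩ := hx
    exact hp v hv _ (Finset.le_sup (f := p) hv)
  | zero => rw [pairing_zero_right]
  | add x y _ _ hx hy => rw [pairing_add_right]; exact add_nonneg hx hy
  | smul c x _ hx =>
    have := pairing_smul_right (w + s.sup p • m) (c : ℝ) x
    change 0 ≤ pairing _ ((c : ℝ) • x)
    rw [this]
    exact mul_nonneg c.2 hx

lemma chartRingHom_single {σ τ : Cone n} (h : τ ≤ σ) (m : dualMonoid σ) (a : k) :
    chartRingHom k h (AddMonoidAlgebra.single m a) =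
      AddMonoidAlgebra.single (AddSubmonoid.inclusion (dualMonoid_anti h) m) a := by
  simp [chartRingHom]

lemma chartRingHom_refl (σ : Cone n) : chartRingHom k (le_refl σ) = RingHom.id _ := by
  have : AddSubmonoid.inclusion (dualMonoid_anti (le_refl σ)) = AddMonoidHom.id _ := rfl
  rw [chartRingHom, this]
  exact AddMonoidAlgebra.mapDomainRingHom_id

lemma chartRingHom_comp {σ τ ρ : Cone n} (h : τ ≤ σ) (h' : ρ ≤ τ) :
    (chartRingHom k h').comp (chartRingHom k h) = chartRingHom k (h'.trans h) := by
  rw [chartRingHom, chartRingHom, ← AddMonoidAlgebra.mapDomainRingHom_comp]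
  rfl

lemma chartRingHom_injective {σ τ : Cone n} (h : τ ≤ σ) :
    Function.Injective (chartRingHom k h) :=
  AddMonoidAlgebra.mapDomain_injective (AddSubmonoid.inclusion_injective _)

/-- `k[S_τ]` is the localization of `k[S_σ]` at `χ^m` for the face `τ = σ ∩ m^⊥`. -/
lemma isLocalization_face {σ : Cone n} (hσ : IsRationalPolyhedral σ) {m : Fin n → ℤ}
    (hm : m ∈ dualMonoid σ) (h : faceOf σ m ≤ σ) :
    let _ := (chartRingHom k h).toAlgebra
    IsLocalization.Away (chi k (⟨m, hm⟩ : dualMonoid σ))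
      (AddMonoidAlgebra k (dualMonoid (faceOf σ m))) := by
  let _ := (chartRingHom k h).toAlgebra
  have halg : ∀ z, algebraMap (AddMonoidAlgebra k (dualMonoid σ))
    (AddMonoidAlgebra k (dualMonoid (faceOf σ m))) z = chartRingHom k h z := fun _ => rfl
  have hneg : -m ∈ dualMonoid (faceOf σ m) := fun v hv => by
    rw [pairing_neg_left, hv.2, neg_zero]
  have hpow : ∀ p : ℕ, algebraMap (AddMonoidAlgebra k (dualMonoid σ))
      (AddMonoidAlgebra k (dualMonoid (faceOf σ m))) (chi k ⟨m, hm⟩ ^ p) =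
      AddMonoidAlgebra.single (p • AddSubmonoid.inclusion (dualMonoid_anti h) ⟨m, hm⟩) 1 := by
    intro p
    rw [halg, map_pow, chi, chartRingHom_single, AddMonoidAlgebra.single_pow, one_pow]
  refine IsLocalization.Away.mk _ ?_ ?_ ?_
  · rw [halg, chi, chartRingHom_single]
    refine IsUnit.of_mul_eq_one (AddMonoidAlgebra.single ⟨-m, hneg⟩ 1) ?_
    rw [AddMonoidAlgebra.single_mul_single, AddMonoidAlgebra.one_def, mul_one]
    congr 1
    ext1
    simp
  · intro z
    induction z using AddMonoidAlgebra.induction_on with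
    | of w =>
      obtain ⟨p, hp⟩ := exists_add_nsmul_mem hσ hm w.2
      refine ⟨p, AddMonoidAlgebra.single ⟨_, hp⟩ 1, ?_⟩
      rw [← map_pow, hpow, halg, chartRingHom_single, AddMonoidAlgebra.of_apply,
        AddMonoidAlgebra.single_mul_single, one_mul]
      rfl
    | add x y hx hy =>
      obtain ⟨p, a, ha⟩ := hx
      obtain ⟨q, b, hb⟩ := hy
      refine ⟨p + q, a * chi k ⟨m, hm⟩ ^ q + b * chi k ⟨m, hm⟩ ^ p, ?_⟩
      rw [map_add, map_mul, map_mul, ← ha, ← hb, pow_add, map_pow, map_pow]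
      ring
    | smul r x hx =>
      obtain ⟨p, a, ha⟩ := hx
      refine ⟨p, AddMonoidAlgebra.single 0 r * a, ?_⟩
      have : r • x = AddMonoidAlgebra.single 0 r * x := by
        ext; simp [AddMonoidAlgebra.coeff_single_zero_mul]
      rw [this, mul_assoc, ha, map_mul, halg (AddMonoidAlgebra.single 0 r), chartRingHom_single,
        map_zero]
  · intro a b hab
    exact ⟨0, by rw [chartRingHom_injective k h hab]⟩


/-- `Spec k[S_τ] → Spec k[S_σ]` is the open immersion with image `D(χ^m)`, if `τ = σ ∩ m^⊥`. -/
lemma chart_face {σ τ : Cone n} (hσ : IsRationalPolyhedral σ) {m : Fin n → ℤ}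
    (hm : m ∈ dualMonoid σ) (e : τ = faceOf σ m) (h : τ ≤ σ) :
    IsOpenImmersion (Spec.map (CommRingCat.ofHom (chartRingHom k h))) ∧
      ∀ z : PrimeSpectrum (AddMonoidAlgebra k (dualMonoid σ)),
        z ∈ Set.range (Spec.map (CommRingCat.ofHom (chartRingHom k h))) ↔
          chi k (⟨m, hm⟩ : dualMonoid σ) ∉ z.asIdeal := by
  subst e
  let _ := (chartRingHom k h).toAlgebra
  have := isLocalization_face k hσ hm h
  exact ⟨IsOpenImmersion.of_isLocalization (chi k (⟨m, hm⟩ : dualMonoid σ)),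
    fun z => Set.ext_iff.1 (PrimeSpectrum.localization_away_comap_range
      (AddMonoidAlgebra k (dualMonoid (faceOf σ m))) (chi k (⟨m, hm⟩ : dualMonoid σ))) z⟩

lemma chart_isOpenImmersion {σ τ : Cone n} (hσ : IsRationalPolyhedral σ) (hτ : IsFace τ σ) :
    IsOpenImmersion (Spec.map (CommRingCat.ofHom (chartRingHom k hτ.le))) := by
  obtain ⟨m, hm, e⟩ := id hτ
  exact (chart_face k hσ hm e hτ.le).1

end charts

section prevariety
variable (k : Type u) [CommRing k] (S : SystemOfFans)

/-- The diagram of the affine charts `U_[σ,i] = Spec k[S_σ]`, indexed by `Ω(S)`. -/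
noncomputable def chartFunctor : S.Omega ⥤ Scheme.{u} where
  obj ω := Spec (.of (AddMonoidAlgebra k (dualMonoid ω.cone)))
  map f := Spec.map (CommRingCat.ofHom (chartRingHom k (SystemOfFans.Omega.isFace f.le).le))
  map_id ω := by
    rw [← Spec.map_id]
    congr 1
    ext : 1
    exact chartRingHom_refl k _
  map_comp f g := by
    rw [← Spec.map_comp, ← CommRingCat.ofHom_comp]
    congr 2
    exact (chartRingHom_comp k _ _).symm

instance {a b : S.Omega} (f : a ⟶ b) : IsOpenImmersion ((chartFunctor k S).map f) :=
  chart_isOpenImmersion k b.rational (SystemOfFans.Omega.isFace f.le)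

lemma SystemOfFans.Omega.inf_of_le {S : SystemOfFans} {a b c : S.Omega} (ha : a ≤ c) (hb : b ≤ c) :
    ∃ d : S.Omega, d ≤ a ∧ d ≤ b ∧ d.cone = a.cone ⊓ b.cone := by
  obtain ⟨i, τ, σ, hτ, hσ, rfl, rfl, h⟩ := ha
  obtain ⟨j, τ', σ', hτ', hσ', rfl, e, h'⟩ := hb
  obtain ⟨rfl, hij⟩ := SystemOfFans.cls_eq_cls.1 e
  have h1 := (S.fan i j).face_mem _ hij _ h
  have h2 := (S.fan i j).face_mem _ hij _ h'
  have h3 := (S.fan i j).inter_face _ h1 _ h2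
  have h4 := (S.fan i j).inter_face _ h2 _ h1
  have h5 := (S.fan i j).face_mem _ h1 _ h3
  have h6 := S.mem_left h5
  have h7 : τ ⊓ τ' ∈ (S.fan j j).cones := S.mem_left (by rwa [S.symm j i])
  refine ⟨SystemOfFans.cls (τ ⊓ τ') i h6, ⟨i, _, _, h6, hτ, rfl, rfl, h3⟩,
    ⟨j, _, _, h7, hτ', SystemOfFans.cls_eq_cls.2 ⟨rfl, h5⟩, rfl, ?_⟩, rfl⟩
  rwa [inf_comm]

instance : (chartFunctor k S ⋙ Scheme.forget).IsLocallyDirected where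
  cond := by
    intro a b c fa fb xa xb hx
    obtain ⟨d, hda, hdb, hd⟩ := SystemOfFans.Omega.inf_of_le fa.le fb.le
    obtain ⟨m, hm, hma⟩ := SystemOfFans.Omega.isFace fa.le
    obtain ⟨m', hm', hmb⟩ := SystemOfFans.Omega.isFace fb.le
    have hdc : d.cone = faceOf c.cone (m + m') := by
      rw [hd, hma, hmb]
      apply le_antisymm
      · intro v hv
        exact ⟨hv.1.1, (pairing_add_left m m' v).trans (by rw [hv.1.2, hv.2.2, add_zero])⟩
      · intro v hv
        have := (pairing_add_left m m' v).symm.trans hv.2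
        have h1 := hm v hv.1
        have h2 := hm' v hv.1
        exact ⟨⟨hv.1, by linarith⟩, ⟨hv.1, by linarith⟩⟩
    let z : PrimeSpectrum (AddMonoidAlgebra k (dualMonoid c.cone)) := (chartFunctor k S).map fa xa
    have hz : (chartFunctor k S).map fa xa = (chartFunctor k S).map fb xb := hx
    have h1 : chi k (⟨m, hm⟩ : dualMonoid c.cone) ∉ z.asIdeal :=
      ((chart_face k c.rational hm hma (SystemOfFans.Omega.isFace fa.le).le).2 z).1 ⟨xa, rfl⟩
    have h2 : chi k (⟨m', hm'⟩ : dualMonoid c.cone) ∉ z.asIdeal :=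
      ((chart_face k c.rational hm' hmb (SystemOfFans.Omega.isFace fb.le).le).2 z).1 ⟨xb, hz.symm⟩
    have h3 : chi k (⟨m + m', add_mem hm hm'⟩ : dualMonoid c.cone) ∉ z.asIdeal := by
      have : chi k (⟨m + m', add_mem hm hm'⟩ : dualMonoid c.cone) =
          chi k ⟨m, hm⟩ * chi k ⟨m', hm'⟩ := by
        rw [chi, chi, chi, AddMonoidAlgebra.single_mul_single, one_mul]
        rfl
      rw [this]
      exact fun h => (z.isPrime.mem_or_mem h).elim h1 h2
    obtain ⟨y, hy⟩ := ((chart_face k c.rational (add_mem hm hm') hdc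
      (SystemOfFans.Omega.isFace (hda.trans fa.le)).le).2 z).2 h3
    have key : ∀ {e : S.Omega} (f : d ⟶ e) (g : e ⟶ c) (x : (chartFunctor k S).obj e),
        (chartFunctor k S).map g x = z → (chartFunctor k S).map f y = x := by
      intro e f g x hgx
      apply ((chartFunctor k S).map g).isOpenEmbedding.injective
      rw [hgx]
      refine Eq.trans ?_ hy
      exact congr($((chartFunctor k S).map_comp f g) y).symm
    exact ⟨d, homOfLE hda, homOfLE hdb, y, key (homOfLE hda) fa xa (Eq.refl z), key (homOfLE hdb) fb xb hz.symm⟩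

/-- The toric prevariety `X(S)` over `k`: the gluing of the affine charts `Spec k[S_σ]`. -/
noncomputable def toricPrevariety : Over (Spec (.of k)) :=
  Over.mk (colimit.desc (chartFunctor k S)
    { pt := Spec (.of k)
      ι :=
        { app := fun ω => Spec.map (CommRingCat.ofHom
            (algebraMap k (AddMonoidAlgebra k (dualMonoid ω.cone))))
          naturality := fun a b f => by
            dsimp [chartFunctor]
            rw [Category.comp_id, ← Spec.map_comp, ← CommRingCat.ofHom_comp]
            congr 2
            exact AddMonoidAlgebra.mapDomainRingHom_comp_algebraMap _ } })

/-- The open immersion `U_[σ,i] → X(S)`. -/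
noncomputable def chart (ω : S.Omega) :
    Spec (.of (AddMonoidAlgebra k (dualMonoid ω.cone))) ⟶ (toricPrevariety k S).left :=
  colimit.ι (chartFunctor k S) ω

instance (ω : S.Omega) : IsOpenImmersion (chart k S ω) :=
  inferInstanceAs (IsOpenImmersion (colimit.ι (chartFunctor k S) ω))

lemma exists_mem_chart (x : (toricPrevariety k S).left) :
    ∃ ω : S.Omega, x ∈ chart k S ω ''ᵁ ⊤ := by
  obtain ⟨ω, z, hz⟩ := Scheme.IsLocallyDirected.ι_jointly_surjective (chartFunctor k S) x
  exact ⟨ω, z, trivial, hz⟩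

lemma chart_comp_hom (ω : S.Omega) : chart k S ω ≫ (toricPrevariety k S).hom =
    Spec.map (CommRingCat.ofHom (algebraMap k (AddMonoidAlgebra k (dualMonoid ω.cone)))) :=
  colimit.ι_desc _ _

variable {k S}

/-- An open subset `U ⊆ X(S)` is torus-invariant if its preimages under the action
`T × X(S) → X(S)` and under the second projection agree. Over the chart `U_[σ,i]` one has
`T × U_[σ,i] = Spec k[M × S_σ]`, the projection is given by `χ^s ↦ χ^(0,s)` and the action
is given by `χ^s ↦ χ^(s,s)`. -/
def IsTorusInvariant (U : (toricPrevariety k S).left.Opens) : Prop :=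
  ∀ ω : S.Omega,
    Spec.map (CommRingCat.ofHom (AddMonoidAlgebra.mapDomainRingHom k
      ((dualMonoid ω.cone).subtype.prod (AddMonoidHom.id (dualMonoid ω.cone))))) ⁻¹ᵁ
        (chart k S ω ⁻¹ᵁ U) =
    Spec.map (CommRingCat.ofHom (AddMonoidAlgebra.mapDomainRingHom k
      (AddMonoidHom.inr (Fin S.rank → ℤ) (dualMonoid ω.cone)))) ⁻¹ᵁ
        (chart k S ω ⁻¹ᵁ U)

variable (k) in
/-- The inclusion `T = Spec k[M] → U_[σ,i] → X(S)` of the big torus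
(which does not depend on the chart). -/
noncomputable def torusMap (ω : S.Omega) :
    Spec (.of (AddMonoidAlgebra k (Fin S.rank → ℤ))) ⟶ (toricPrevariety k S).left :=
  Spec.map (CommRingCat.ofHom (AddMonoidAlgebra.mapDomainRingHom k
    (dualMonoid ω.cone).subtype)) ≫ chart k S ω

/-- A regular function on an open subset `U ⊆ X(S)` is a monomial if its restriction to the big
torus is of the form `a χ^m` with `m ∈ M` and `a ≠ 0`. -/
def IsMonomial {U : (toricPrevariety k S).left.Opens} (g : Γ((toricPrevariety k S).left, U)) :
    Prop :=
  ∃ (a : k) (m : Fin S.rank → ℤ), a ≠ 0 ∧ ∀ ω : S.Omega,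
    (torusMap k ω).app U g =
      (Spec (.of (AddMonoidAlgebra k (Fin S.rank → ℤ)))).presheaf.map (homOfLE le_top).op
        ((Scheme.ΓSpecIso (.of (AddMonoidAlgebra k (Fin S.rank → ℤ)))).inv
          (AddMonoidAlgebra.single m a))

end prevariety

/-! ### Toric morphisms -/

/-- A morphism `(F, 𝔣)` of systems of fans: a homomorphism `F : N → N'`, given by a matrix, and an
order preserving map `𝔣 : Ω(S) → Ω(S')` such that `F_ℝ(σ) ⊆ σ'` whenever `𝔣[σ,i] = [σ',i']`. -/
structure ToricHom (S S' : SystemOfFans) where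
  mat : Matrix (Fin S'.rank) (Fin S.rank) ℤ
  onOmega : S.Omega → S'.Omega
  monotone : Monotone onOmega
  map_cone : ∀ ω : S.Omega, ∀ v ∈ ω.cone,
    (mat.map (fun z : ℤ => (z : ℝ))).mulVec v ∈ (onOmega ω).cone

namespace ToricHom
variable {S S' : SystemOfFans} (φ : ToricHom S S')

/-- The dual homomorphism `F^* : S_σ' → S_σ` for `𝔣[σ,i] = [σ',i']`. -/
def dual (ω : S.Omega) : dualMonoid (φ.onOmega ω).cone →+ dualMonoid ω.cone where
  toFun m := ⟨Matrix.vecMul m.1 φ.mat, fun v hv => by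
    have h := m.2 _ (φ.map_cone ω v hv)
    have e : pairing (Matrix.vecMul m.1 φ.mat) v =
        pairing m.1 ((φ.mat.map (fun z : ℤ => (z : ℝ))).mulVec v) := by
      simp only [pairing, Matrix.vecMul, Matrix.mulVec, dotProduct, Matrix.map_apply,
        Int.cast_sum, Int.cast_mul, Finset.sum_mul, Finset.mul_sum]
      rw [Finset.sum_comm]
      exact Finset.sum_congr rfl fun _ _ => Finset.sum_congr rfl fun _ _ => mul_assoc _ _ _
    rw [e]
    exact h⟩
  map_zero' := Subtype.ext (Matrix.zero_vecMul φ.mat)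
  map_add' a b := Subtype.ext (Matrix.add_vecMul φ.mat a.1 b.1)

lemma inclusion_comp_dual {a b : S.Omega} (h : a ≤ b) :
    (AddSubmonoid.inclusion (dualMonoid_anti (SystemOfFans.Omega.isFace h).le)).comp (φ.dual b) =
    (φ.dual a).comp (AddSubmonoid.inclusion
      (dualMonoid_anti (SystemOfFans.Omega.isFace (φ.monotone h)).le)) := by
  ext m : 2
  rfl

variable (k : Type u) [CommRing k]

/-- The morphism of schemes over `k` induced by a morphism of systems of fans. -/
noncomputable def toScheme : toricPrevariety k S ⟶ toricPrevariety k S' :=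
  Over.homMk (colimit.desc (chartFunctor k S)
    { pt := (toricPrevariety k S').left
      ι :=
        { app := fun ω => Spec.map (CommRingCat.ofHom
            (AddMonoidAlgebra.mapDomainRingHom k (φ.dual ω))) ≫ chart k S' (φ.onOmega ω)
          naturality := fun a b f => by
            have h := φ.monotone f.le
            have e : chart k S' (φ.onOmega a) =
              (chartFunctor k S').map (homOfLE h) ≫ chart k S' (φ.onOmega b) :=
              (colimit.w (chartFunctor k S') (homOfLE h)).symm
            dsimp [chartFunctor] at e ⊢
            rw [Category.comp_id, e, ← Category.assoc, ← Category.assoc, ← Spec.map_comp,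
              ← Spec.map_comp, ← CommRingCat.ofHom_comp, ← CommRingCat.ofHom_comp]
            congr 3
            rw [chartRingHom, chartRingHom, ← AddMonoidAlgebra.mapDomainRingHom_comp,
              ← AddMonoidAlgebra.mapDomainRingHom_comp, φ.inclusion_comp_dual f.le] } })
    (by
      refine colimit.hom_ext fun ω => ?_
      refine Eq.trans ?_ (chart_comp_hom k S ω).symm
      have e : Spec.map (CommRingCat.ofHom (AddMonoidAlgebra.mapDomainRingHom k (φ.dual ω))) ≫
          chart k S' (φ.onOmega ω) ≫ (toricPrevariety k S').hom =
          Spec.map (CommRingCat.ofHom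
            (algebraMap k (AddMonoidAlgebra k (dualMonoid ω.cone)))) := by
        rw [chart_comp_hom, ← Spec.map_comp, ← CommRingCat.ofHom_comp]
        congr 2
        exact AddMonoidAlgebra.mapDomainRingHom_comp_algebraMap _
      refine Eq.trans ?_ e
      exact (colimit.ι_desc_assoc _ _ _).trans (Category.assoc _ _ _))

end ToricHom

/-! ### Berkovich analytification and Raynaud generic fiber -/

/-- The two variants of analytification and tropicalization: the Berkovich analytification together
with the tropicalization, and the Raynaud generic fiber together with the non-negative
tropicalization. -/
inductive Kind
  | full
  | nonneg

/-- The pullback of a multiplicative seminorm along a ring homomorphism. -/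
def seminormComp {A B : Type*} [CommRing A] [CommRing B] (p : MulRingSeminorm B) (f : A →+* B) :
    MulRingSeminorm A where
  toFun a := p (f a)
  map_zero' := by rw [map_zero, map_zero]
  add_le' a b := by rw [map_add]; exact map_add_le_add p _ _
  neg' a := by rw [map_neg, map_neg_eq_map]
  map_one' := by rw [map_one, map_one]
  map_mul' a b := by rw [map_mul, map_mul]

section analytification
variable {k : Type u} [CommRing k]

/-- The image of `a ∈ k` in the local ring of the `k`-scheme `Y` at `y`. -/
noncomputable def constGerm (Y : Over (Spec (CommRingCat.of k))) (y : Y.left) (a : k) :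
    Y.left.presheaf.stalk y :=
  Y.left.presheaf.germ ⊤ y trivial (Y.hom.appTop ((Scheme.ΓSpecIso (.of k)).inv a))

lemma stalkMap_constGerm {Y X : Over (Spec (CommRingCat.of k))} (i : Y ⟶ X) (y : Y.left) (a : k) :
    i.left.stalkMap y (constGerm X (i.left y) a) = constGerm Y y a := by
  have h : i.left ≫ X.hom = Y.hom := Over.w i
  have h' : Y.hom.appTop = X.hom.appTop ≫ i.left.appTop := by
    rw [← Scheme.Hom.comp_appTop, h]
  refine (Scheme.Hom.germ_stalkMap_apply i.left ⊤ y trivial _).trans ?_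
  rw [constGerm, h']
  rfl

variable [Norm k]

/-- Points of the Berkovich analytification `Y^an` of a scheme `Y` over a non-Archimedean field `k`
(for `.full`), respectively of the Raynaud generic fiber `Y^∘` of a scheme `Y` over a
valuation ring `k` (for `.nonneg`).

A point of `Y^an` is a point `y ∈ Y` together with a multiplicative seminorm on `𝒪_{Y,y}` that
extends the absolute value of `k` and has kernel `𝔪_y`, i.e. an absolute value on the residue field
`κ(y)`. On an affine open subset `Spec A` these are the multiplicative seminorms on `A` that extend
the absolute value of `k`, where `y` is the kernel of the seminorm.

A point of `Y^∘` is a point `y ∈ Y` together with a multiplicative seminorm on `𝒪_{Y,y}` that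
extends the absolute value of `k`, is bounded by `1`, and is less than `1` exactly on `𝔪_y`.
On an affine open subset `Spec A` these are the multiplicative seminorms on `A` that extend the
absolute value of `k` and are bounded by `1`, where `y` is the reduction `{f ∈ A : |f| < 1}` of the
seminorm (so that `y` lies in a smaller affine open subset `Spec B` if and only if the seminorm
comes from a seminorm bounded by `1` on `B`). -/
structure AnPoint (κ : Kind) (Y : Over (Spec (CommRingCat.of k))) where
  pt : Y.left
  seminorm : MulRingSeminorm (Y.left.presheaf.stalk pt)
  seminorm_const : ∀ a : k, seminorm (constGerm Y pt a) = ‖a‖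
  center : match κ with
    | .full => ∀ f, seminorm f = 0 ↔ ¬ IsUnit f
    | .nonneg => ∀ f, seminorm f ≤ 1 ∧ (seminorm f < 1 ↔ ¬ IsUnit f)

variable {κ : Kind} {Y X : Over (Spec (CommRingCat.of k))}

/-- The value `|f|_x` of a section `f` over an open neighbourhood `U` of (the center of) `x`. -/
noncomputable def AnPoint.eval (x : AnPoint κ Y) (U : Y.left.Opens) (hx : x.pt ∈ U)
    (f : Γ(Y.left, U)) : ℝ :=
  x.seminorm (Y.left.presheaf.germ U x.pt hx f)

/-- For each affine open `U ⊆ Y` the subset `U^an` (resp. `U^∘`) carries the weakest topology for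
which all evaluation maps `x ↦ |f|_x`, `f ∈ 𝒪(U)`, are continuous. The whole space is the colimit of
these subspaces: a subset is open if and only if its intersection with each of them is open. -/
noncomputable instance : TopologicalSpace (AnPoint κ Y) :=
  ⨆ U : Y.left.affineOpens,
    TopologicalSpace.coinduced (Subtype.val : {x : AnPoint κ Y // x.pt ∈ U.1} → AnPoint κ Y)
      (⨅ f : Γ(Y.left, U.1), TopologicalSpace.induced
        (fun x : {x : AnPoint κ Y // x.pt ∈ U.1} => x.1.eval U.1 x.2 f) inferInstance)

/-- The map `i^an : Y^an → X^an` (resp. `i^∘ : Y^∘ → X^∘`) induced by a morphism `i : Y → X`. -/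
noncomputable def AnPoint.map (i : Y ⟶ X) (y : AnPoint κ Y) : AnPoint κ X where
  pt := i.left y.pt
  seminorm := seminormComp y.seminorm (i.left.stalkMap y.pt).hom
  seminorm_const a :=
    (congrArg y.seminorm (stalkMap_constGerm i y.pt a)).trans (y.seminorm_const a)
  center := by
    have h := y.center
    cases κ with
    | full =>
      intro f
      exact (h _).trans (not_congr (isUnit_map_iff (i.left.stalkMap y.pt).hom f))
    | nonneg =>
      intro f
      exact ⟨(h _).1, (h _).2.trans (not_congr (isUnit_map_iff (i.left.stalkMap y.pt).hom f))⟩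

end analytification

/-! ### Tropical toric prevarieties -/

/-- The affine tropical toric variety `U_σ^trop = Hom(S_σ, ℝ ∪ {∞})`, respectively its
non-negative version `U_σ^{trop,≥0} = Hom(S_σ, ℝ_{≥0} ∪ {∞})`. -/
def TropChart (κ : Kind) {n : ℕ} (σ : Cone n) :=
  {u : dualMonoid σ →+ WithTop ℝ // κ = .nonneg → ∀ s, 0 ≤ u s}

/-- The weakest topology for which all evaluation maps `u ↦ u(s)` are continuous. -/
instance (κ : Kind) {n : ℕ} (σ : Cone n) : TopologicalSpace (TropChart κ σ) :=
  ⨅ s : dualMonoid σ, TopologicalSpace.induced (fun u => u.1 s) inferInstance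

/-- Composition with a homomorphism of monoids. -/
def TropChart.comp {κ : Kind} {n n' : ℕ} {σ : Cone n} {σ' : Cone n'} (u : TropChart κ σ)
    (f : dualMonoid σ' →+ dualMonoid σ) : TropChart κ σ' :=
  ⟨u.1.comp f, fun h s => u.2 h (f s)⟩

section tropical
variable {κ : Kind} {S S' : SystemOfFans}

/-- The map `U_[τ,j]^trop → U_[σ,i]^trop` for `[τ,j] ≼ [σ,i]`. -/
def TropChart.extend {a b : S.Omega} (h : a ≤ b) (u : TropChart κ a.cone) : TropChart κ b.cone :=
  u.comp (AddSubmonoid.inclusion (dualMonoid_anti (SystemOfFans.Omega.isFace h).le))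

variable (κ S) in
/-- A point of `U_[τ,j]^trop` is identified with its images in `U_[σ,i]^trop`
for `[τ,j] ≼ [σ,i]`. -/
def TropRel (p q : Σ ω : S.Omega, TropChart κ ω.cone) : Prop :=
  ∃ h : p.1 ≤ q.1, q.2 = p.2.extend h

variable (κ S) in
/-- The tropical toric prevariety `X^trop` (for `.full`) and the non-negative tropical
toric prevariety `X^{trop,≥0}` (for `.nonneg`) of `X = X(S)`: the colimit, with the colimit topology,
of the affine pieces indexed by `Ω(S)`. -/
def TropSpace := Quot (TropRel κ S)

instance : TopologicalSpace (TropSpace κ S) :=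
  inferInstanceAs (TopologicalSpace (Quot (TropRel κ S)))

/-- The map `φ^trop : X^trop → X'^trop` (resp. `φ^{trop,≥0}`) of a toric morphism `φ`. -/
def tropMap (φ : ToricHom S S') : TropSpace κ S → TropSpace κ S' :=
  Quot.map (fun p => ⟨φ.onOmega p.1, p.2.comp (φ.dual p.1)⟩) (by
    rintro ⟨a, u⟩ ⟨b, v⟩ ⟨h, e⟩
    dsimp only at h e
    subst e
    exact ⟨φ.monotone h, Subtype.ext (AddMonoidHom.ext fun s => rfl)⟩)

/-- `-log : ℝ_{≥0} → ℝ ∪ {∞}`. -/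
noncomputable def negLog (r : ℝ) : WithTop ℝ :=
  if r = 0 then ⊤ else ((-Real.log r : ℝ) : WithTop ℝ)

lemma negLog_one : negLog 1 = 0 := by simp [negLog]

lemma negLog_mul (r t : ℝ) : negLog (r * t) = negLog r + negLog t := by
  by_cases hr : r = 0
  · simp [negLog, hr]
  by_cases ht : t = 0
  · simp [negLog, ht]
  · simp only [negLog, hr, ht, mul_eq_zero, or_self, if_false]
    rw [Real.log_mul hr ht, neg_add, WithTop.coe_add]

lemma negLog_nonneg {r : ℝ} (h0 : 0 ≤ r) (h1 : r ≤ 1) : 0 ≤ negLog r := by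
  unfold negLog
  split_ifs
  · exact le_top
  · exact WithTop.coe_nonneg.2 (neg_nonneg.2 (Real.log_nonpos h0 h1))

variable {k : Type u} [CommRing k] [Norm k]

/-- The value `|f|_x` of `f ∈ k[S_σ]` at a point `x` of the chart `U_[σ,i]`. -/
noncomputable def chartEval (x : AnPoint κ (toricPrevariety k S)) (ω : S.Omega)
    (hx : x.pt ∈ chart k S ω ''ᵁ ⊤) (f : AddMonoidAlgebra k (dualMonoid ω.cone)) : ℝ :=
  x.eval _ hx (((chart k S ω).appIso ⊤).inv ((Scheme.ΓSpecIso (.of _)).inv f))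

lemma chartEval_one (x : AnPoint κ (toricPrevariety k S)) (ω : S.Omega)
    (hx : x.pt ∈ chart k S ω ''ᵁ ⊤) : chartEval x ω hx 1 = 1 := by
  rw [chartEval, AnPoint.eval]
  simp only [map_one]

lemma chartEval_mul (x : AnPoint κ (toricPrevariety k S)) (ω : S.Omega)
    (hx : x.pt ∈ chart k S ω ''ᵁ ⊤) (f g : AddMonoidAlgebra k (dualMonoid ω.cone)) :
    chartEval x ω hx (f * g) = chartEval x ω hx f * chartEval x ω hx g := by
  rw [chartEval, AnPoint.eval]
  simp only [map_mul]
  rfl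

lemma chartEval_nonneg (x : AnPoint κ (toricPrevariety k S)) (ω : S.Omega)
    (hx : x.pt ∈ chart k S ω ''ᵁ ⊤) (f : AddMonoidAlgebra k (dualMonoid ω.cone)) :
    0 ≤ chartEval x ω hx f :=
  apply_nonneg x.seminorm _

lemma chartEval_le_one (h : κ = .nonneg) (x : AnPoint κ (toricPrevariety k S)) (ω : S.Omega)
    (hx : x.pt ∈ chart k S ω ''ᵁ ⊤) (f : AddMonoidAlgebra k (dualMonoid ω.cone)) :
    chartEval x ω hx f ≤ 1 := by
  subst h
  exact (x.center _).1

/-- The tropicalization map `x ↦ (s ↦ -log |χ^s|_x)` on the chart `U_[σ,i]`. -/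
noncomputable def tropChart (x : AnPoint κ (toricPrevariety k S)) (ω : S.Omega)
    (hx : x.pt ∈ chart k S ω ''ᵁ ⊤) : TropChart κ ω.cone :=
  ⟨{ toFun := fun s => negLog (chartEval x ω hx (chi k s))
     map_zero' := by
       have : chi k (0 : dualMonoid ω.cone) = 1 := rfl
       rw [this, chartEval_one, negLog_one]
     map_add' := fun s t => by
       have : chi k (s + t) = chi k s * chi k t := by
         rw [chi, chi, chi, AddMonoidAlgebra.single_mul_single, one_mul]
       rw [this, chartEval_mul, negLog_mul] },
    fun h s => negLog_nonneg (chartEval_nonneg x ω hx _) (chartEval_le_one h x ω hx _)⟩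

/-- The tropicalization map `X^an → X^trop` (resp. `X^∘ → X^{trop,≥0}`) of `X = X(S)`, given by
`x ↦ (s ↦ -log |χ^s|_x)` on a chart that contains `x`. -/
noncomputable def trop (x : AnPoint κ (toricPrevariety k S)) : TropSpace κ S :=
  Quot.mk _ ⟨(exists_mem_chart k S x.pt).choose,
    tropChart x _ (exists_mem_chart k S x.pt).choose_spec⟩

end tropical

/-! ### Systems of embeddings and limits of tropicalizations -/

section systems
variable {k : Type u} [CommRing k]

/-- A locally closed embedding of the `k`-scheme `Y` into a toric prevariety over `k`. -/
structure ToricEmbedding (Y : Over (Spec (CommRingCat.of k))) where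
  S : SystemOfFans
  map : Y ⟶ toricPrevariety k S
  isImmersion : IsImmersion map.left

/-- A system of locally closed embeddings of `Y` into toric prevarieties: a family of embeddings
together with a collection of toric morphisms between them. -/
structure EmbeddingSystem (Y : Over (Spec (CommRingCat.of k))) where
  J : Type w
  emb : J → ToricEmbedding Y
  Mor : ∀ a b : J, Set (ToricHom (emb a).S (emb b).S)
  comm : ∀ a b : J, ∀ φ ∈ Mor a b, (emb a).map ≫ φ.toScheme k = (emb b).map

namespace EmbeddingSystem
variable {Y : Over (Spec (CommRingCat.of k))} (𝓘 : EmbeddingSystem.{u, w} Y)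

/-- For any two embeddings `Y → X_a` and `Y → X_b` in the system the product embedding
`Y → X_c = X_a ×_k X_b` and the projections `X_c → X_a` and `X_c → X_b` belong to the system. -/
def ClosedUnderProducts : Prop :=
  ∀ a b : 𝓘.J, ∃ (c : 𝓘.J), ∃ p ∈ 𝓘.Mor c a, ∃ q ∈ 𝓘.Mor c b,
    Nonempty (IsLimit (BinaryFan.mk (p.toScheme k) (q.toScheme k)))

/-- Property `(+)`: for every `y ∈ Y` there are an embedding `i : Y → X` in the system and a
torus-invariant affine open `U ⊆ X` containing `i(y)` such that `i⁻¹(U) → U` is a closed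
embedding. -/
def PropertyPlus : Prop :=
  ∀ y : Y.left, ∃ (j : 𝓘.J) (U : (toricPrevariety k (𝓘.emb j).S).left.Opens),
    IsTorusInvariant U ∧ IsAffineOpen U ∧ (𝓘.emb j).map.left y ∈ U ∧
      IsClosedImmersion ((𝓘.emb j).map.left ∣_ U)

/-- Property `(∗)`: there is a finite affine open cover `Y = V_1 ∪ ... ∪ V_r` such that for every
`k` and every regular function `f` on `V_k` there is an embedding `i : Y → X` in the system such
that `V_k` is the preimage of a torus-invariant open subset `U ⊆ X` and `f` is the pullback of a
monomial on `U`. -/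
def PropertyStar : Prop :=
  ∃ (r : ℕ) (V : Fin r → Y.left.Opens), (∀ l, IsAffineOpen (V l)) ∧ ⨆ l, V l = ⊤ ∧
    ∀ (l : Fin r) (f : Γ(Y.left, V l)),
      ∃ (j : 𝓘.J) (U : (toricPrevariety k (𝓘.emb j).S).left.Opens)
        (g : Γ((toricPrevariety k (𝓘.emb j).S).left, U)),
        IsTorusInvariant U ∧ IsMonomial g ∧
          ∃ h : V l = (𝓘.emb j).map.left ⁻¹ᵁ U, (𝓘.emb j).map.left.appLE U (V l) h.le g = f

variable [Norm k] (κ : Kind)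

/-- The map `trop_i = trop_X ∘ i^an` (resp. `trop_X^{≥0} ∘ i^∘`). -/
noncomputable def tropEmb (j : 𝓘.J) (y : AnPoint κ Y) : TropSpace κ (𝓘.emb j).S :=
  trop (y.map (𝓘.emb j).map)

/-- The tropicalization `Trop(Y, i)` (resp. the non-negative tropicalization `Trop^{≥0}(Y, i)`). -/
def Trop (j : 𝓘.J) : Set (TropSpace κ (𝓘.emb j).S) := Set.range (𝓘.tropEmb κ j)

/-- The inverse limit of the tropicalizations `Trop(Y, i)` (resp. `Trop^{≥0}(Y, i)`), with the
subspace topology of the product. -/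
abbrev Lim :=
  {x : ∀ j : 𝓘.J, 𝓘.Trop κ j //
    ∀ a b : 𝓘.J, ∀ φ ∈ 𝓘.Mor a b, tropMap φ (x a).1 = (x b).1}

end EmbeddingSystem
end systems

end ToricTrop

/-! By `(∗)` the tropicalizations record the absolute values of all regular functions on the
finitely many affine opens `V_l`. If `f` on `V_l` is the pullback of a monomial `a χ^m` on a
torus-invariant open `U ⊆ X_j`, then `|f|_y = |a| exp(-u(m))` for `u = trop_j(y)`. This is a
continuous function of `trop_j(y)`, and `trop_j(y)` also decides whether the center of `y` lies in
`V_l` (`exists_eval_eq_tropEmb`). Injectivity follows, since a point is determined by its values on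
one affine open containing its center (`AnPoint.ext_of_eval`).

For surjectivity, every element of `Trop(Y, j)` comes from an actual point, and closure under
products realizes any finitely many coordinates of a point `x` of the limit by a single `y`
(`exists_tropEmb_eq`). Reading off values from `x` gives a function on some `𝒪(V_l)`. Each seminorm
axiom involves only finitely many regular functions, so it is inherited from such a `y`. The
resulting seminorm is a point of the analytification (`AnPoint.exists_of_seminorm`), and it
tropicalizes to `x` because each coordinate of `trop_j` is determined by finitely many functions on
`V_l` (`tropEmb_eq_of_approx`). The inverse is continuous because all evaluations are continuous on
the pieces of a finite cover of the limit.

Both kinds are treated at once. A function is invertible at the center exactly when its value is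
`Kind.Good`, and such loci are open in `Y^an` but closed in `Y^∘`, which is `Kind.Nice`. Finite
covers by such sets suffice for gluing continuous maps, and tropical charts embed with `Nice` image.
The geometric input is `IsTorusInvariant.exists_chart_le`: a torus-invariant open around a center
contains a whole chart around it, provided that non-unit constants do not have `Good` norm. -/

namespace ToricTrop

open Topology Filter

/-! ### The exponential coordinate on `ℝ ∪ {∞}`. -/

/-- The inverse `t ↦ exp (-t)` of `negLog`. -/
noncomputable def expNeg (t : WithTop ℝ) : ℝ :=
  WithTop.recTopCoe 0 (fun r => Real.exp (-r)) t

@[simp] lemma expNeg_top : expNeg ⊤ = 0 := rfl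

@[simp] lemma expNeg_coe (r : ℝ) : expNeg (r : WithTop ℝ) = Real.exp (-r) := rfl

lemma expNeg_nonneg (t : WithTop ℝ) : 0 ≤ expNeg t := by
  induction t using WithTop.recTopCoe with
  | top => exact le_rfl
  | coe r => exact (Real.exp_pos _).le

lemma negLog_expNeg (t : WithTop ℝ) : negLog (expNeg t) = t := by
  induction t using WithTop.recTopCoe with
  | top => simp [negLog]
  | coe r => simp [negLog]

lemma expNeg_negLog {r : ℝ} (hr : 0 ≤ r) : expNeg (negLog r) = r := by
  rcases hr.eq_or_lt with rfl | hr
  · simp [negLog]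
  · rw [negLog, if_neg hr.ne', expNeg_coe, neg_neg, Real.exp_log hr]

lemma expNeg_injective : Function.Injective expNeg :=
  Function.LeftInverse.injective negLog_expNeg

@[simp] lemma expNeg_zero : expNeg 0 = 1 := by
  rw [← WithTop.coe_zero, expNeg_coe]; simp

lemma expNeg_add (s t : WithTop ℝ) : expNeg (s + t) = expNeg s * expNeg t := by
  induction s using WithTop.recTopCoe with
  | top => simp
  | coe r =>
    induction t using WithTop.recTopCoe with
    | top => simp
    | coe r' => rw [← WithTop.coe_add, expNeg_coe, expNeg_coe, expNeg_coe, ← Real.exp_add, neg_add]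

lemma expNeg_le_one_iff (t : WithTop ℝ) : expNeg t ≤ 1 ↔ 0 ≤ t := by
  induction t using WithTop.recTopCoe with
  | top => simp
  | coe r => rw [WithTop.coe_nonneg]; simp

lemma continuous_expNeg : Continuous expNeg := by
  rw [continuous_iff_continuousAt]
  intro t
  induction t using WithTop.recTopCoe with
  | top =>
    rw [ContinuousAt, expNeg_top, Metric.tendsto_nhds]
    intro ε hε
    filter_upwards [lt_mem_nhds (WithTop.coe_lt_top (-Real.log ε))] with t ht
    rw [Real.dist_0_eq_abs, abs_of_nonneg (expNeg_nonneg t)]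
    induction t using WithTop.recTopCoe with
    | top => exact hε
    | coe r =>
      rw [expNeg_coe, ← Real.lt_log_iff_exp_lt hε]
      have := WithTop.coe_lt_coe.1 ht
      linarith
  | coe r =>
    rw [ContinuousAt, WithTop.nhds_coe, tendsto_map'_iff]
    exact (Real.continuous_exp.comp continuous_neg).continuousAt

lemma continuousOn_negLog : ContinuousOn negLog (Set.Ici 0) := by
  intro r hr
  rcases (show 0 ≤ r from hr).eq_or_lt with rfl | hr
  · rw [ContinuousWithinAt, show negLog 0 = ⊤ by simp [negLog], WithTop.tendsto_nhds_top_iff]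
    intro i
    filter_upwards [mem_nhdsWithin_of_mem_nhds (gt_mem_nhds (Real.exp_pos (-i))),
      self_mem_nhdsWithin] with r hr hr0
    rcases (show 0 ≤ r from hr0).eq_or_lt with rfl | h
    · simp [negLog]
    · rw [negLog, if_neg h.ne', WithTop.coe_lt_coe]
      have := (Real.log_lt_iff_lt_exp h).2 hr
      linarith
  · refine ContinuousAt.continuousWithinAt ?_
    refine ContinuousAt.congr (f := fun r => ((-Real.log r : ℝ) : WithTop ℝ)) ?_ ?_
    · exact WithTop.continuous_coe.continuousAt.comp (Real.continuousAt_log hr.ne').neg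
    · filter_upwards [isOpen_ne.mem_nhds hr.ne'] with r hr
      rw [negLog, if_neg hr]

/-- On `[0, ∞)` the map `negLog` is a continuous left inverse. Hence continuity into tropical charts
can be tested with real-valued coordinates, where `∞` becomes the harmless value `0`. -/
lemma isInducing_expNeg : IsInducing expNeg := by
  have h : IsInducing (fun t => (⟨expNeg t, expNeg_nonneg t⟩ : Set.Ici (0 : ℝ))) := by
    refine IsInducing.of_comp (g := (Set.Ici (0 : ℝ)).domRestrict negLog)
      (continuous_expNeg.subtype_mk _) continuousOn_negLog.domRestrict ?_
    have : (Set.Ici (0 : ℝ)).domRestrict negLog ∘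
      (fun t => (⟨expNeg t, expNeg_nonneg t⟩ : Set.Ici (0 : ℝ))) = id := funext negLog_expNeg
    rw [this]
    exact IsInducing.id
  exact IsInducing.subtypeVal.comp h

/-! ### Open conditions for `Y^an` and closed conditions for `Y^∘`. -/

/-- The values of an absolute value that signify invertibility: nonzero for `.full`, and at
least `1` for `.nonneg`. -/
def Kind.Good (κ : Kind) (r : ℝ) : Prop :=
  match κ with
  | .full => r ≠ 0
  | .nonneg => 1 ≤ r

/-- Open for `.full`, closed for `.nonneg`. -/
def Kind.Nice (κ : Kind) {X : Type*} [TopologicalSpace X] (s : Set X) : Prop :=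
  match κ with
  | .full => IsOpen s
  | .nonneg => IsClosed s

namespace Kind

lemma Good.ne_zero {κ : Kind} {r : ℝ} (h : κ.Good r) : r ≠ 0 := by
  cases κ with
  | full => exact h
  | nonneg => exact (zero_lt_one.trans_le h).ne'

lemma good_one (κ : Kind) : κ.Good 1 := by
  cases κ with
  | full => exact one_ne_zero
  | nonneg => exact le_rfl

lemma Good.mul {κ : Kind} {r t : ℝ} (hr : κ.Good r) (ht : κ.Good t) : κ.Good (r * t) := by
  cases κ with
  | full => exact mul_ne_zero hr ht
  | nonneg => exact one_le_mul_of_one_le_of_one_le hr ht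

lemma Nice.preimage {κ : Kind} {X Z : Type*} [TopologicalSpace X] [TopologicalSpace Z]
    {s : Set Z} (h : κ.Nice s) {f : X → Z} (hf : Continuous f) : κ.Nice (f ⁻¹' s) := by
  cases κ with
  | full => exact IsOpen.preimage hf h
  | nonneg => exact IsClosed.preimage hf h

lemma nice_good (κ : Kind) : κ.Nice {r | κ.Good r} := by
  cases κ with
  | full => exact isOpen_ne
  | nonneg => exact isClosed_Ici

lemma nice_iUnion (κ : Kind) {X ι : Type*} [TopologicalSpace X] [Finite ι] {s : ι → Set X}
    (h : ∀ i, κ.Nice (s i)) : κ.Nice (⋃ i, s i) := by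
  cases κ with
  | full => exact isOpen_iUnion h
  | nonneg => exact isClosed_iUnion_of_finite h

/-- Continuity can be checked on a finite cover by open (resp. closed) sets. -/
lemma continuous_of_nice_cover (κ : Kind) {X Z ι : Type*} [TopologicalSpace X]
    [TopologicalSpace Z] [Finite ι] {s : ι → Set X} (h : ∀ i, κ.Nice (s i))
    (hs : ∀ x, ∃ i, x ∈ s i) {f : X → Z} (hf : ∀ i, Continuous ((s i).domRestrict f)) :
    Continuous f := by
  cases κ with
  | full =>
    rw [continuous_iff_continuousAt]
    intro x
    obtain ⟨i, hi⟩ := hs x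
    exact (continuousOn_iff_continuous_domRestrict.2 (hf i)).continuousAt (IsOpen.mem_nhds (h i) hi)
  | nonneg =>
    refine (locallyFinite_of_finite s).continuous (Set.iUnion_eq_univ_iff.2 hs) h
      fun i => continuousOn_iff_continuous_domRestrict.2 (hf i)

/-- An inducing map with open (resp. closed) range maps open (resp. closed) sets to such. -/
lemma Nice.image {κ : Kind} {X Z : Type*} [TopologicalSpace X] [TopologicalSpace Z]
    {s : Set X} (h : κ.Nice s) {f : X → Z} (hf : IsInducing f) (hr : κ.Nice (Set.range f)) :
    κ.Nice (f '' s) := by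
  cases κ with
  | full => exact hf.isOpenMap hr _ h
  | nonneg => exact hf.isClosedMap hr _ h

lemma isInducing_of_nice_image {κ : Kind} {X Z : Type*} [TopologicalSpace X] [TopologicalSpace Z]
    {f : X → Z} (hc : Continuous f) (hi : Function.Injective f)
    (h : ∀ s, κ.Nice s → κ.Nice (f '' s)) : IsInducing f := by
  cases κ with
  | full => exact (IsOpenEmbedding.of_continuous_injective_isOpenMap hc hi h).isInducing
  | nonneg => exact (IsClosedEmbedding.of_continuous_injective_isClosedMap hc hi h).isInducing

end Kind

/-! ### Multiplicative seminorms. -/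

/-- Extension of a multiplicative seminorm to a localization. -/
lemma exists_seminorm_localization {A B : Type*} [CommRing A] [CommRing B] [Algebra A B]
    (M : Submonoid A) [IsLocalization M B] (p : MulRingSeminorm A) (hp : ∀ m ∈ M, p m ≠ 0) :
    ∃ q : MulRingSeminorm B, ∀ a, q (algebraMap A B a) = p a := by
  let g : A →* ℝ := ⟨⟨p, map_one p⟩, map_mul p⟩
  have hg : ∀ m : M, IsUnit (g m) := fun m => isUnit_iff_ne_zero.2 (hp m m.2)
  let L := (IsLocalization.toLocalizationMap M B).lift hg
  have hL : ∀ a, L (algebraMap A B a) = p a := fun a =>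
    (IsLocalization.toLocalizationMap M B).lift_eq hg a
  have hz : L 0 = 0 := by rw [← map_zero (algebraMap A B), hL, map_zero]
  have hnn : ∀ b, 0 ≤ L b := by
    intro b
    obtain ⟨a, m, rfl⟩ := IsLocalization.exists_mk'_eq M b
    have h := congrArg L (IsLocalization.mk'_spec B a m)
    rw [map_mul, hL, hL] at h
    have hm : 0 < p (m : A) := lt_of_le_of_ne (apply_nonneg p _) (hp m m.2).symm
    by_contra hneg
    have := mul_neg_of_neg_of_pos (not_le.1 hneg) hm
    have := apply_nonneg p a
    linarith
  refine ⟨{ toFun := L, map_zero' := hz, add_le' := ?_, neg' := ?_,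
                map_one' := map_one L, map_mul' := map_mul L }, hL⟩
  · intro x y
    obtain ⟨a, m, rfl⟩ := IsLocalization.exists_mk'_eq M x
    obtain ⟨b, n, rfl⟩ := IsLocalization.exists_mk'_eq M y
    have hu : IsUnit (algebraMap A B (m * n : M)) := IsLocalization.map_units B (m * n)
    have h0 : L (algebraMap A B (m * n : M)) ≠ 0 := by rw [hL]; exact hp _ (m * n).2
    have hpos := lt_of_le_of_ne (hnn _) h0.symm
    -- Clearing the common denominator `mn` reduces the claim to the triangle inequality for `an +
    -- bm` in `A`.
    refine le_of_mul_le_mul_right ?_ hpos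
    have e1 : IsLocalization.mk' B a m * algebraMap A B (m * n : M) = algebraMap A B (a * n) := by
      rw [Submonoid.coe_mul, map_mul, ← mul_assoc, IsLocalization.mk'_spec, map_mul]
    have e2 : IsLocalization.mk' B b n * algebraMap A B (m * n : M) = algebraMap A B (b * m) := by
      rw [mul_comm m n, Submonoid.coe_mul, map_mul, ← mul_assoc, IsLocalization.mk'_spec, map_mul]
    rw [add_mul, ← map_mul, ← map_mul, ← map_mul, add_mul, e1, e2, ← map_add, hL, hL, hL]
    exact map_add_le_add p _ _
  · intro x
    have h : L (-1) = 1 := by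
      have : L (-1) = p (-1) := by rw [← hL, RingHom.map_neg, RingHom.map_one]
      rw [this, map_neg_eq_map, map_one]
    change L (-x) = L x
    rw [← neg_one_mul, map_mul, h, one_mul]

/-- A multiplicative seminorm that is bounded by `1` satisfies the strong triangle inequality. -/
lemma seminorm_add_lt_one {A : Type*} [CommRing A] (p : MulRingSeminorm A) (hp : ∀ a, p a ≤ 1)
    {a b : A} (ha : p a < 1) (hb : p b < 1) : p (a + b) < 1 := by
  set r := max (p a) (p b) with hr
  have hr1 : r < 1 := max_lt ha hb
  have hr0 : 0 ≤ r := (apply_nonneg p a).trans (le_max_left _ _)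
  -- Binomial expansion: there are `n + 1` terms, and each is at most `r ^ n` because binomial
  -- coefficients have value at most `1`.
  have key : ∀ n : ℕ, p (a + b) ^ n ≤ n * r ^ n + r ^ n := by
    intro n
    rw [← map_pow, add_pow]
    refine (Finset.le_sum_of_subadditive p (map_zero p).le (map_add_le_add p) _ _).trans ?_
    refine (Finset.sum_le_card_nsmul _ _ (r ^ n) fun i hi => ?_).trans_eq ?_
    · rw [map_mul, map_mul, map_pow, map_pow]
      have hi : i ≤ n := by simpa [Nat.lt_succ_iff] using hi
      have h1 : p a ^ i ≤ r ^ i := pow_le_pow_left₀ (apply_nonneg p a) (le_max_left _ _) i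
      have h2 : p b ^ (n - i) ≤ r ^ (n - i) :=
        pow_le_pow_left₀ (apply_nonneg p b) (le_max_right _ _) _
      calc p a ^ i * p b ^ (n - i) * p ((n.choose i : ℕ) : A)
          ≤ p a ^ i * p b ^ (n - i) :=
            mul_le_of_le_one_right (mul_nonneg (pow_nonneg (apply_nonneg p a) _)
              (pow_nonneg (apply_nonneg p b) _)) (hp _)
        _ ≤ r ^ i * r ^ (n - i) := mul_le_mul h1 h2 (pow_nonneg (apply_nonneg p b) _)
              (pow_nonneg hr0 _)
        _ = r ^ n := by rw [← pow_add, Nat.add_sub_cancel' hi]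
    · rw [Finset.card_range, nsmul_eq_mul]; push_cast; ring
  -- If `p (a + b) ≥ 1`, its powers stay at least `1`, while the bound `(n + 1) r ^ n` tends to `0`.
  by_contra! h
  have hlim := (tendsto_self_mul_const_pow_of_lt_one hr0 hr1).add
    (tendsto_pow_atTop_nhds_zero_of_lt_one hr0 hr1)
  rw [add_zero] at hlim
  obtain ⟨n, hn⟩ := (hlim.eventually (gt_mem_nhds zero_lt_one)).exists
  exact (key n).not_gt (hn.trans_le (one_le_pow₀ h))

lemma mem_primeIdealOf {X : Scheme.{u}} {U : X.Opens} (hU : IsAffineOpen U) {x : X} (hx : x ∈ U)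
    (f : Γ(X, U)) : f ∈ (hU.primeIdealOf ⟨x, hx⟩).asIdeal ↔ x ∉ X.basicOpen f := by
  rw [hU.primeIdealOf_eq_map_closedPoint, Scheme.mem_basicOpen _ _ _ hx]
  exact Iff.rfl

/-! ### Points of the analytification as seminorms on affine opens. -/

section anpoint

variable {k : Type u} [CommRing k] [Norm k] {κ : Kind} {Y X : Over (Spec (CommRingCat.of k))}

namespace AnPoint

/-- This is the condition `center` in a form common to both kinds. It is the link between absolute
values and the position of the center. -/
lemma good_seminorm_iff (x : AnPoint κ Y) (f : Y.left.presheaf.stalk x.pt) :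
    κ.Good (x.seminorm f) ↔ IsUnit f := by
  have h := x.center
  cases κ with
  | full => exact (not_congr (h f)).trans not_not
  | nonneg => exact not_lt.symm.trans ((not_congr (h f).2).trans not_not)

lemma good_eval_iff (x : AnPoint κ Y) {U : Y.left.Opens} (hx : x.pt ∈ U) (f : Γ(Y.left, U)) :
    κ.Good (x.eval U hx f) ↔ x.pt ∈ Y.left.basicOpen f :=
  (x.good_seminorm_iff _).trans (Scheme.mem_basicOpen _ _ _ hx).symm

/-- The multiplicative seminorm `f ↦ |f|_x` on the sections over a neighbourhood of the center. -/
noncomputable def evalSeminorm (x : AnPoint κ Y) {U : Y.left.Opens} (hx : x.pt ∈ U) :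
    MulRingSeminorm Γ(Y.left, U) :=
  seminormComp x.seminorm (Y.left.presheaf.germ U x.pt hx).hom

lemma eval_mul (x : AnPoint κ Y) {U : Y.left.Opens} (hx : x.pt ∈ U) (f g : Γ(Y.left, U)) :
    x.eval U hx (f * g) = x.eval U hx f * x.eval U hx g := by
  rw [eval, map_mul, map_mul]; rfl

lemma eval_pow (x : AnPoint κ Y) {U : Y.left.Opens} (hx : x.pt ∈ U) (f : Γ(Y.left, U)) (n : ℕ) :
    x.eval U hx (f ^ n) = x.eval U hx f ^ n := by
  rw [eval, map_pow, map_pow]; rfl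

lemma eval_map (x : AnPoint κ Y) {U V : Y.left.Opens} (i : V ⟶ U) (hx : x.pt ∈ V)
    (f : Γ(Y.left, U)) :
    x.eval V hx (Y.left.presheaf.map i.op f) = x.eval U (i.le hx) f := by
  rw [eval, eval, TopCat.Presheaf.germ_res_apply]

/-- Write `h = a / f ^ n`. Since `a` and `n` do not depend on `x`, both continuity and equality of
values pass from `U` to `D(f)`. -/
lemma exists_eval_basicOpen_eq {U : Y.left.Opens} (hU : IsAffineOpen U) (f : Γ(Y.left, U))
    (h : Γ(Y.left, Y.left.basicOpen f)) : ∃ (n : ℕ) (a : Γ(Y.left, U)), ∀ (x : AnPoint κ Y)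
      (hx : x.pt ∈ Y.left.basicOpen f), x.eval _ hx h =
        x.eval U (Y.left.basicOpen_le f hx) a / x.eval U (Y.left.basicOpen_le f hx) f ^ n := by
  have := hU.isLocalization_basicOpen f
  obtain ⟨n, a, ha⟩ := IsLocalization.Away.surj f h
  refine ⟨n, a, fun x hx => ?_⟩
  have e := ((x.good_eval_iff (Y.left.basicOpen_le f hx) f).2 hx).ne_zero
  rw [eq_div_iff (pow_ne_zero _ e)]
  have h1 := congrArg (x.eval _ hx) ha
  rw [eval_mul, eval_pow] at h1
  have h2 := fun b => x.eval_map (homOfLE (Y.left.basicOpen_le f)) hx b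
  rw [← h2, ← h2]
  exact h1

lemma map_eval (x : AnPoint κ Y) (i : Y ⟶ X) {U : X.left.Opens} {V : Y.left.Opens}
    (h : V ≤ i.left ⁻¹ᵁ U) (hx : x.pt ∈ V) (f : Γ(X.left, U)) :
    (x.map i).eval U (h hx) f = x.eval V hx (i.left.appLE U V h f) := by
  refine congrArg x.seminorm ?_
  refine (Scheme.Hom.germ_stalkMap_apply i.left U x.pt (h hx) f).trans ?_
  exact (TopCat.Presheaf.germ_res_apply Y.left.presheaf (homOfLE h) x.pt hx _).symm

/-- The prime ideal of the center consists of the functions whose value is not `Good`, so the values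
determine the center. The stalk there is a localization, and a multiplicative seminorm on it is
determined by numerators and denominators. -/
lemma ext_of_eval {x x' : AnPoint κ Y} {U : Y.left.Opens} (hU : IsAffineOpen U) (hx : x.pt ∈ U)
    (hx' : x'.pt ∈ U) (h : ∀ f, x.eval U hx f = x'.eval U hx' f) : x = x' := by
  have hpt : x.pt = x'.pt := by
    have h1 : hU.primeIdealOf ⟨x.pt, hx⟩ = hU.primeIdealOf ⟨x'.pt, hx'⟩ := by
      ext f
      rw [mem_primeIdealOf, mem_primeIdealOf, ← good_eval_iff x hx, h, good_eval_iff x' hx']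
    exact ((hU.fromSpec_primeIdealOf ⟨x.pt, hx⟩).symm.trans
      (congrArg _ h1)).trans (hU.fromSpec_primeIdealOf ⟨x'.pt, hx'⟩)
  obtain ⟨y, p, h1, h2⟩ := x
  obtain ⟨y', p', h1', h2'⟩ := x'
  obtain rfl : y = y' := hpt
  obtain rfl : p = p' := by
    let := Y.left.presheaf.algebra_section_stalk ⟨y, hx⟩
    have := hU.isLocalization_stalk ⟨y, hx⟩
    refine DFunLike.ext _ _ fun z => ?_
    obtain ⟨a, m, rfl⟩ := IsLocalization.exists_mk'_eq
      (hU.primeIdealOf ⟨y, hx⟩).asIdeal.primeCompl z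
    have hm : IsUnit (algebraMap Γ(Y.left, U) (Y.left.presheaf.stalk y) m) :=
      IsLocalization.map_units _ m
    have h3 : p (algebraMap Γ(Y.left, U) (Y.left.presheaf.stalk y) m) ≠ 0 := by
      intro h0
      obtain ⟨c, hc⟩ := hm.exists_right_inv
      have h4 := congrArg p hc
      rw [map_mul, h0, zero_mul, map_one] at h4
      exact zero_ne_one h4
    have e := IsLocalization.mk'_spec (Y.left.presheaf.stalk y) a m
    have e1 := congrArg p e
    have e2 := congrArg p' e
    rw [map_mul] at e1 e2
    have h5 : ∀ f, p (algebraMap Γ(Y.left, U) (Y.left.presheaf.stalk y) f) =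
      p' (algebraMap Γ(Y.left, U) (Y.left.presheaf.stalk y) f) := h
    rw [← h5, ← h5, ← e1] at e2
    exact (mul_right_cancel₀ h3 e2).symm
  rfl

/-- The constant function `a ∈ k` on `U`. -/
noncomputable def const (Y : Over (Spec (CommRingCat.of k))) (U : Y.left.Opens) (a : k) :
    Γ(Y.left, U) :=
  Y.left.presheaf.map (homOfLE le_top).op (Y.hom.appTop ((Scheme.ΓSpecIso (.of k)).inv a))

lemma eval_const (x : AnPoint κ Y) {U : Y.left.Opens} (hx : x.pt ∈ U) (a : k) :
    x.eval U hx (const Y U a) = ‖a‖ := by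
  rw [const, eval_map]
  exact x.seminorm_const a

/-- The functions of non-`Good` value form a prime ideal: the kernel of `p` for `.full`, the
reduction `{p < 1}` for `.nonneg`. It serves as the center, and `p` extends to the local ring there
because it does not vanish off this ideal. -/
lemma exists_of_seminorm {U : Y.left.Opens} (hU : IsAffineOpen U)
    (p : MulRingSeminorm Γ(Y.left, U)) (hp : ∀ a, p (const Y U a) = ‖a‖)
    (hp1 : κ = .nonneg → ∀ f, p f ≤ 1) :
    ∃ (x : AnPoint κ Y) (hx : x.pt ∈ U), ∀ f, x.eval U hx f = p f := by
  have hmul : ∀ a b, ¬ κ.Good (p b) → ¬ κ.Good (p (a * b)) := by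
    intro a b hb
    rw [map_mul]
    cases κ with
    | full =>
      have : p b = 0 := not_not.1 hb
      exact not_not.2 (by rw [this, mul_zero])
    | nonneg =>
      exact not_le.2 ((mul_le_of_le_one_left (apply_nonneg p b) (hp1 rfl a)).trans_lt (not_le.1 hb))
  let I : Ideal Γ(Y.left, U) :=
    { carrier := {f | ¬ κ.Good (p f)}
      zero_mem' := fun h => h.ne_zero (map_zero p)
      add_mem' := by
        intro a b ha hb
        cases κ with
        | full =>
          have ha : p a = 0 := not_not.1 ha
          have hb : p b = 0 := not_not.1 hb
          refine not_not.2 (le_antisymm ?_ (apply_nonneg p _))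
          exact (map_add_le_add p a b).trans (by rw [ha, hb, add_zero])
        -- The ordinary triangle inequality would only give `p (a + b) < 2`; boundedness by `1`
        -- upgrades it.
        | nonneg => exact not_le.2 (seminorm_add_lt_one p (hp1 rfl) (not_le.1 ha) (not_le.1 hb))
      smul_mem' := hmul }
  have hI : I.IsPrime := by
    refine ⟨fun h => ?_, fun {a b} hab => ?_⟩
    · have : (1 : Γ(Y.left, U)) ∈ I := by rw [h]; trivial
      exact this (by rw [map_one]; exact κ.good_one)
    · by_contra! h
      have ha : κ.Good (p a) := not_not.1 h.1
      have hb : κ.Good (p b) := not_not.1 h.2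
      refine hab ?_
      rw [map_mul]
      exact ha.mul hb
  obtain ⟨y, hy, hyI⟩ : ∃ (y : Y.left) (hy : y ∈ U), (hU.primeIdealOf ⟨y, hy⟩).asIdeal = I := by
    refine ⟨(hU.isoSpec.inv ⟨I, hI⟩).1, (hU.isoSpec.inv ⟨I, hI⟩).2, ?_⟩
    have : ∀ z, hU.isoSpec.hom (hU.isoSpec.inv z) = z := fun z => by
      rw [← Scheme.Hom.comp_apply, Iso.inv_hom_id]; rfl
    exact congrArg PrimeSpectrum.asIdeal (this ⟨I, hI⟩)
  let := Y.left.presheaf.algebra_section_stalk ⟨y, hy⟩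
  have := hU.isLocalization_stalk ⟨y, hy⟩
  obtain ⟨q, hq⟩ := exists_seminorm_localization (B := Y.left.presheaf.stalk y)
    (hU.primeIdealOf ⟨y, hy⟩).asIdeal.primeCompl p (fun m hm => by
      refine Kind.Good.ne_zero (κ := κ) ?_
      have : m ∉ I := hyI ▸ hm
      exact not_not.1 this)
  have hfrac : ∀ z, ∃ a m, q z * p m = p a ∧ κ.Good (p m) ∧ (IsUnit z ↔ κ.Good (p a)) := by
    intro z
    obtain ⟨a, m, rfl⟩ := IsLocalization.exists_mk'_eq
      (hU.primeIdealOf ⟨y, hy⟩).asIdeal.primeCompl z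
    have hm : m.1 ∉ I := hyI ▸ m.2
    refine ⟨a, m, ?_, not_not.1 hm, ?_⟩
    · rw [← hq, ← hq, ← map_mul, IsLocalization.mk'_spec]
    · rw [IsLocalization.AtPrime.isUnit_mk'_iff _ (hU.primeIdealOf ⟨y, hy⟩).asIdeal]
      have : a ∈ (hU.primeIdealOf ⟨y, hy⟩).asIdeal ↔ a ∈ I := by rw [hyI]
      exact (not_congr this).trans not_not
  refine ⟨⟨y, q, fun a => ?_, ?_⟩, hy, hq⟩
  · rw [← hp, ← hq]
    refine congrArg q ?_
    exact (TopCat.Presheaf.germ_res_apply Y.left.presheaf (homOfLE le_top) y hy _).symm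
  · cases κ with
    | full =>
      intro f
      obtain ⟨a, m, h1, h2, h3⟩ := hfrac f
      have h2 : p m ≠ 0 := h2
      have h4 : q f = 0 ↔ p a = 0 := by rw [← h1, mul_eq_zero, or_iff_left h2]
      exact h4.trans (not_not.symm.trans (not_congr h3.symm))
    | nonneg =>
      intro f
      obtain ⟨a, m, h1, h2, h3⟩ := hfrac f
      -- Denominators have value exactly `1`, so a fraction has the value of its numerator and the
      -- bound by `1` survives localization.
      rw [le_antisymm (hp1 rfl m) h2, mul_one] at h1
      rw [h1]
      exact ⟨hp1 rfl a, not_le.symm.trans (not_congr h3.symm)⟩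

end AnPoint

/-! ### The topology of the analytification. -/

variable (κ Y) in
/-- The subset `U^an` (resp. `U^∘`) with the topology generated by the functions `x ↦ |f|_x`. -/
def AnOn (U : Y.left.Opens) := {x : AnPoint κ Y // x.pt ∈ U}

noncomputable instance (U : Y.left.Opens) : TopologicalSpace (AnOn κ Y U) :=
  ⨅ f : Γ(Y.left, U), TopologicalSpace.induced (fun x => x.1.eval U x.2 f) inferInstance

lemma continuous_anPoint_iff {Z : Type*} [TopologicalSpace Z] {f : AnPoint κ Y → Z} :
    Continuous f ↔ ∀ U : Y.left.affineOpens, Continuous (fun x : AnOn κ Y U.1 => f x.1) :=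
  continuous_iSup_dom.trans (forall_congr' fun _ => continuous_coinduced_dom)

namespace AnOn

variable {U : Y.left.Opens}

lemma continuous_val (hU : IsAffineOpen U) : Continuous (fun x : AnOn κ Y U => x.1) :=
  continuous_anPoint_iff.1 continuous_id ⟨U, hU⟩

lemma continuous_iff {Z : Type*} [TopologicalSpace Z] {g : Z → AnOn κ Y U} :
    Continuous g ↔ ∀ f, Continuous fun z => (g z).1.eval U (g z).2 f :=
  continuous_iInf_rng.trans (forall_congr' fun _ => continuous_induced_rng)

lemma continuous_eval (f : Γ(Y.left, U)) : Continuous fun x : AnOn κ Y U => x.1.eval U x.2 f :=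
  continuous_iff.1 continuous_id f

lemma continuous_eval_basicOpen (hU : IsAffineOpen U) (f : Γ(Y.left, U))
    (h : Γ(Y.left, Y.left.basicOpen f)) :
    Continuous fun x : {x : AnOn κ Y U // x.1.pt ∈ Y.left.basicOpen f} => x.1.1.eval _ x.2 h := by
  obtain ⟨n, a, ha⟩ := AnPoint.exists_eval_basicOpen_eq (κ := κ) hU f h
  have e : ∀ x : {x : AnOn κ Y U // x.1.pt ∈ Y.left.basicOpen f},
      x.1.1.eval U x.1.2 f ≠ 0 := fun x => ((x.1.1.good_eval_iff x.1.2 f).2 x.2).ne_zero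
  simp only [ha]
  exact ((continuous_eval a).comp continuous_subtype_val).div
    (((continuous_eval f).comp continuous_subtype_val).pow n) fun x => pow_ne_zero _ (e x)

/-- The center lies in `D(f)` exactly when `|f|` is `Good`: the open condition `|f| ≠ 0` for
`.full`, the closed condition `|f| ≥ 1` for `.nonneg`. -/
lemma nice_basicOpen (f : Γ(Y.left, U)) :
    κ.Nice {x : AnOn κ Y U | x.1.pt ∈ Y.left.basicOpen f} := by
  have : {x : AnOn κ Y U | x.1.pt ∈ Y.left.basicOpen f} =
      (fun x : AnOn κ Y U => x.1.eval U x.2 f) ⁻¹' {r | κ.Good r} :=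
    Set.ext fun x => (x.1.good_eval_iff x.2 f).symm
  rw [this]
  exact κ.nice_good.preimage (continuous_eval f)

end AnOn

/-- A map on `Y^an` (resp. `Y^∘`) is continuous if it is continuous on `D(f)^an` for arbitrarily
small principal open subsets `D(f)` of affine open subsets of `Y`. -/
lemma continuous_anPoint_of_basicOpen {Z : Type*} [TopologicalSpace Z] {F : AnPoint κ Y → Z}
    (h : ∀ y : Y.left, ∃ W : Y.left.Opens, y ∈ W ∧ ∀ U : Y.left.affineOpens, ∀ f : Γ(Y.left, U.1),
      Y.left.basicOpen f ≤ W →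
      Continuous fun x : {x : AnOn κ Y U.1 // x.1.pt ∈ Y.left.basicOpen f} => F x.1.1) :
    Continuous F := by
  refine continuous_anPoint_iff.2 fun U => ?_
  choose W hyW hW using h
  have h1 : ∀ y : U.1, ∃ f : Γ(Y.left, U.1), Y.left.basicOpen f ≤ W y ∧ y.1 ∈ Y.left.basicOpen f :=
    fun y => U.2.exists_basicOpen_le ⟨y, hyW y⟩ y.2
  choose f hf hyf using h1
  -- Finiteness matters for `.nonneg`: there the pieces are closed, and continuity is glued along a
  -- finite closed cover.
  obtain ⟨t, ht⟩ := U.2.isCompact.elim_finite_subcover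
    (fun y : U.1 => (Y.left.basicOpen (f y) : Set Y.left)) (fun y => (Y.left.basicOpen (f y)).2)
    (fun y hy => Set.mem_iUnion.2 ⟨⟨y, hy⟩, hyf ⟨y, hy⟩⟩)
  refine Kind.continuous_of_nice_cover κ (ι := t)
    (s := fun y => {x : AnOn κ Y U.1 | x.1.pt ∈ Y.left.basicOpen (f y)})
    (fun y => AnOn.nice_basicOpen _) (fun x => ?_) fun y => hW y U (f y) (hf y)
  obtain ⟨y, hy, h⟩ := Set.mem_iUnion₂.1 (ht x.2)
  exact ⟨⟨y, hy⟩, h⟩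

end anpoint

/-! ### Tropical charts and their faces. -/

lemma neg_mem_dualMonoid_faceOf {n : ℕ} (σ : Cone n) (m : Fin n → ℤ) :
    -m ∈ dualMonoid (faceOf σ m) := fun v hv => by
  rw [pairing_neg_left, hv.2, neg_zero]

namespace TropChart

variable {κ : Kind} {n : ℕ} {σ τ : Cone n}

/-- The coordinate `u ↦ exp (-u(s))`. -/
noncomputable def coord (u : TropChart κ σ) (s : dualMonoid σ) : ℝ := expNeg (u.1 s)

lemma ext_coord {u v : TropChart κ σ} (h : ∀ s, u.coord s = v.coord s) : u = v :=
  Subtype.ext (AddMonoidHom.ext fun s => expNeg_injective (h s))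

lemma coord_add (u : TropChart κ σ) (s t : dualMonoid σ) :
    u.coord (s + t) = u.coord s * u.coord t := by
  rw [coord, map_add, expNeg_add]; rfl

lemma coord_zero (u : TropChart κ σ) : u.coord 0 = 1 := by
  rw [coord, map_zero, expNeg_zero]

lemma coord_nsmul (u : TropChart κ σ) (p : ℕ) (s : dualMonoid σ) :
    u.coord (p • s) = u.coord s ^ p := by
  induction p with
  | zero => rw [zero_smul, coord_zero, pow_zero]
  | succ p ih => rw [succ_nsmul, coord_add, ih, pow_succ]

lemma coord_nonneg (u : TropChart κ σ) (s : dualMonoid σ) : 0 ≤ u.coord s := expNeg_nonneg _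

lemma coord_le_one (u : TropChart κ σ) (h : κ = .nonneg) (s : dualMonoid σ) : u.coord s ≤ 1 :=
  (expNeg_le_one_iff _).2 (u.2 h s)

lemma continuous_iff {Z : Type*} [TopologicalSpace Z] {f : Z → TropChart κ σ} :
    Continuous f ↔ ∀ s, Continuous fun z => (f z).coord s := by
  refine continuous_iInf_rng.trans (forall_congr' fun s => continuous_induced_rng.trans ?_)
  exact isInducing_expNeg.continuous_iff

lemma continuous_coord (s : dualMonoid σ) : Continuous fun u : TropChart κ σ => u.coord s :=
  continuous_iff.1 continuous_id s

/-- The coordinates at `s` and `-s` multiply to `1`. Hence they are nonzero, and for `.nonneg`,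
where both are at most `1`, they equal `1`. -/
lemma good_of_neg_mem (u : TropChart κ σ) (s t : dualMonoid σ) (h : s + t = 0) :
    κ.Good (u.coord s) := by
  have h1 := u.coord_add s t
  rw [h, coord_zero] at h1
  cases κ with
  | full => exact left_ne_zero_of_mul (h1 ▸ one_ne_zero)
  | nonneg =>
    have h2 := mul_le_of_le_one_right (u.coord_nonneg s) (u.coord_le_one rfl t)
    exact h1.trans_le h2

/-- The map `U_τ^trop → U_σ^trop` for `τ ⊆ σ`. -/
def incl (h : τ ≤ σ) (u : TropChart κ τ) : TropChart κ σ :=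
  u.comp (AddSubmonoid.inclusion (dualMonoid_anti h))

lemma incl_coord (h : τ ≤ σ) (u : TropChart κ τ) (s : dualMonoid σ) :
    (u.incl h).coord s = u.coord (AddSubmonoid.inclusion (dualMonoid_anti h) s) := rfl

lemma continuous_incl (h : τ ≤ σ) : Continuous (incl h : TropChart κ τ → TropChart κ σ) :=
  continuous_iff.2 fun s => continuous_coord (AddSubmonoid.inclusion (dualMonoid_anti h) s)

/-- The point of a tropical chart with given coordinates `exp (-u(s))`. -/
noncomputable def ofCoord (c : dualMonoid σ → ℝ) (h0 : c 0 = 1)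
    (hadd : ∀ s t, c (s + t) = c s * c t) (hle : κ = .nonneg → ∀ s, 0 ≤ c s ∧ c s ≤ 1) :
    TropChart κ σ :=
  ⟨{ toFun := fun s => negLog (c s)
     map_zero' := by rw [h0, negLog_one]
     map_add' := fun s t => by rw [hadd, negLog_mul] },
    fun h s => negLog_nonneg (hle h s).1 (hle h s).2⟩

lemma ofCoord_coord {c : dualMonoid σ → ℝ} {h0 : c 0 = 1}
    {hadd : ∀ s t, c (s + t) = c s * c t} {hle : κ = .nonneg → ∀ s, 0 ≤ c s ∧ c s ≤ 1}
    {s : dualMonoid σ} (hs : 0 ≤ c s) : (ofCoord (κ := κ) c h0 hadd hle).coord s = c s :=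
  expNeg_negLog hs

section face

variable {m : Fin n → ℤ} (hm : m ∈ dualMonoid σ) (h : faceOf σ m ≤ σ)

include hm

lemma good_incl (w : TropChart κ (faceOf σ m)) : κ.Good ((w.incl h).coord ⟨m, hm⟩) :=
  w.good_of_neg_mem _ ⟨-m, neg_mem_dualMonoid_faceOf σ m⟩ (Subtype.ext (add_neg_cancel m))

/-- After cross-multiplication both sides are the coordinate at `s + (p + q) m`. This makes the
extension of `u` to lattice points `s` outside `S_σ` well defined. -/
lemma coord_div_congr (u : TropChart κ σ) (hu0 : u.coord ⟨m, hm⟩ ≠ 0) {s : Fin n → ℤ} {p q : ℕ}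
    (hp : s + p • m ∈ dualMonoid σ) (hq : s + q • m ∈ dualMonoid σ) :
    u.coord ⟨s + p • m, hp⟩ / u.coord ⟨m, hm⟩ ^ p =
      u.coord ⟨s + q • m, hq⟩ / u.coord ⟨m, hm⟩ ^ q := by
  rw [div_eq_div_iff (pow_ne_zero _ hu0) (pow_ne_zero _ hu0), ← coord_nsmul, ← coord_nsmul,
    ← coord_add, ← coord_add]
  exact congrArg u.coord (Subtype.ext (add_right_comm _ _ _))

lemma incl_faceOf_coord (w : TropChart κ (faceOf σ m)) (s : dualMonoid (faceOf σ m)) (p : ℕ)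
    (hp : s.1 + p • m ∈ dualMonoid σ) :
    w.coord s = (w.incl h).coord ⟨s.1 + p • m, hp⟩ / (w.incl h).coord ⟨m, hm⟩ ^ p := by
  rw [eq_div_iff (pow_ne_zero _ (good_incl hm h w).ne_zero), incl_coord, incl_coord, ← coord_nsmul,
    ← coord_add]
  rfl

variable (hσ : IsRationalPolyhedral σ)
include hσ

lemma incl_face_injective : Function.Injective (incl h : TropChart κ (faceOf σ m) → _) := by
  intro w w' e
  refine ext_coord fun s => ?_
  obtain ⟨p, hp⟩ := exists_add_nsmul_mem hσ hm s.2
  rw [incl_faceOf_coord hm h w s p hp, incl_faceOf_coord hm h w' s p hp, e]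

/-- The monoid `S_τ` of the face arises from `S_σ` by inverting `m`, so the coordinate at `s` has to
be that at `s + pm` divided by the `p`-th power of that at `m`. -/
lemma exists_incl_eq (u : TropChart κ σ) (hu : κ.Good (u.coord ⟨m, hm⟩)) :
    ∃ w : TropChart κ (faceOf σ m), w.incl h = u := by
  have hu0 : u.coord ⟨m, hm⟩ ≠ 0 := Kind.Good.ne_zero hu
  choose p hp using fun s : dualMonoid (faceOf σ m) => exists_add_nsmul_mem hσ hm s.2
  obtain ⟨c, hc⟩ : ∃ c : dualMonoid (faceOf σ m) → ℝ,
      ∀ (s : dualMonoid (faceOf σ m)) (q : ℕ) (hq : s.1 + q • m ∈ dualMonoid σ),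
      c s = u.coord ⟨s.1 + q • m, hq⟩ / u.coord ⟨m, hm⟩ ^ q :=
    ⟨fun s => u.coord ⟨s.1 + p s • m, hp s⟩ / u.coord ⟨m, hm⟩ ^ p s,
      fun s q hq => coord_div_congr hm u hu0 (hp s) hq⟩
  have hcm : ∀ s : dualMonoid σ, c (AddSubmonoid.inclusion (dualMonoid_anti h) s) = u.coord s := by
    intro s
    let t := AddSubmonoid.inclusion (dualMonoid_anti h) s
    have e : t.1 + (0 : ℕ) • m = s.1 := by rw [zero_smul, add_zero]; rfl
    have ht : t.1 + (0 : ℕ) • m ∈ dualMonoid σ := by rw [e]; exact s.2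
    have h1 : (⟨t.1 + (0 : ℕ) • m, ht⟩ : dualMonoid σ) = s := Subtype.ext e
    rw [hc t 0 ht, pow_zero, div_one, h1]
  have hnn : ∀ s, 0 ≤ c s := fun s => by
    obtain ⟨p, hp⟩ := exists_add_nsmul_mem hσ hm s.2
    rw [hc s p hp]
    exact div_nonneg (u.coord_nonneg _) (pow_nonneg (u.coord_nonneg _) _)
  refine ⟨ofCoord c ?_ ?_ ?_, ext_coord fun s => ?_⟩
  · have := hcm 0
    rwa [map_zero, coord_zero] at this
  · intro s t
    obtain ⟨p, hp⟩ := exists_add_nsmul_mem hσ hm s.2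
    obtain ⟨q, hq⟩ := exists_add_nsmul_mem hσ hm t.2
    have e : (s + t).1 + (p + q) • m = (s.1 + p • m) + (t.1 + q • m) := by
      rw [add_smul, AddSubmonoid.coe_add, add_add_add_comm]
    rw [hc _ _ (e ▸ add_mem hp hq), hc _ _ hp, hc _ _ hq, div_mul_div_comm, ← pow_add, ← coord_add]
    exact congrArg (fun z => u.coord z / _) (Subtype.ext e)
  · rintro rfl s
    refine ⟨hnn s, ?_⟩
    obtain ⟨p, hp⟩ := exists_add_nsmul_mem hσ hm s.2
    -- For `.nonneg` nothing is really divided, so the extended coordinates remain at most `1`.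
    have h1 : u.coord ⟨m, hm⟩ = 1 := le_antisymm (u.coord_le_one rfl _) hu
    rw [hc _ _ hp, h1, one_pow, div_one]
    exact u.coord_le_one rfl _
  · rw [incl_coord, ofCoord_coord (hnn _), hcm]

/-- Each coordinate on the face chart is a quotient of coordinates on the big chart with
nonvanishing denominator, hence continuous for the induced topology. -/
lemma isInducing_incl_face : IsInducing (incl h : TropChart κ (faceOf σ m) → TropChart κ σ) := by
  refine ⟨le_antisymm (continuous_iff_le_induced.1 (continuous_incl h)) ?_⟩
  refine continuous_id_iff_le.1 ?_
  refine (@continuous_iff κ n (faceOf σ m) (TropChart κ (faceOf σ m))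
    (TopologicalSpace.induced (incl h) inferInstance) id).2 fun s => ?_
  obtain ⟨p, hp⟩ := exists_add_nsmul_mem hσ hm s.2
  simp only [id, incl_faceOf_coord hm h _ s p hp]
  let _ := TopologicalSpace.induced (incl h : TropChart κ (faceOf σ m) → TropChart κ σ)
    inferInstance
  have h1 : Continuous (incl h : TropChart κ (faceOf σ m) → TropChart κ σ) := continuous_induced_dom
  exact ((continuous_coord _).comp h1).div (((continuous_coord _).comp h1).pow p)
    fun w => pow_ne_zero _ (good_incl hm h w).ne_zero

end face

end TropChart

/-! ### Gluing the tropical charts. -/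

section tropSpace

variable {κ : Kind} {S : SystemOfFans}

/-- Needed so that unions indexed by charts stay closed for `.nonneg`. -/
instance : Finite S.Omega := by
  have := S.finite
  have : Finite S.Pair := by
    refine Set.Finite.to_subtype (s := {p : Cone S.rank × S.I | p.1 ∈ (S.fan p.2 p.2).cones}) ?_
    refine Set.Finite.subset (Set.Finite.prod
      (Set.finite_iUnion fun i => (S.fan i i).finite) (Set.finite_univ (α := S.I))) ?_
    exact fun p hp => ⟨Set.mem_iUnion.2 ⟨p.2, hp⟩, trivial⟩
  exact Quotient.finite _

namespace TropChart

lemma extend_injective {a b : S.Omega} (h : a ≤ b) :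
    Function.Injective (extend h : TropChart κ a.cone → TropChart κ b.cone) := by
  obtain ⟨m, hm, e⟩ := SystemOfFans.Omega.isFace h
  have key : ∀ (τ : Cone S.rank) (hτ : τ ≤ b.cone), τ = faceOf b.cone m →
      Function.Injective (incl hτ : TropChart κ τ → TropChart κ b.cone) := by
    rintro _ hτ rfl
    exact incl_face_injective hm hτ b.rational
  exact key _ (SystemOfFans.Omega.isFace h).le e

lemma isInducing_extend {a b : S.Omega} (h : a ≤ b) :
    IsInducing (extend h : TropChart κ a.cone → TropChart κ b.cone) := by
  obtain ⟨m, hm, e⟩ := SystemOfFans.Omega.isFace h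
  have key : ∀ (τ : Cone S.rank) (hτ : τ ≤ b.cone), τ = faceOf b.cone m →
      IsInducing (incl hτ : TropChart κ τ → TropChart κ b.cone) := by
    rintro _ hτ rfl
    exact isInducing_incl_face hm hτ b.rational
  exact key _ (SystemOfFans.Omega.isFace h).le e

/-- Tropical counterpart of the face chart being the principal open subset `D(χ^m)`. -/
lemma mem_range_extend {a b : S.Omega} (h : a ≤ b) {m : Fin S.rank → ℤ}
    (hm : m ∈ dualMonoid b.cone) (e : a.cone = faceOf b.cone m) (u : TropChart κ b.cone) :
    u ∈ Set.range (extend h : TropChart κ a.cone → TropChart κ b.cone) ↔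
      κ.Good (u.coord ⟨m, hm⟩) := by
  have key : ∀ (τ : Cone S.rank) (hτ : τ ≤ b.cone), τ = faceOf b.cone m →
      (u ∈ Set.range (incl hτ : TropChart κ τ → TropChart κ b.cone) ↔
        κ.Good (u.coord ⟨m, hm⟩)) := by
    rintro _ hτ rfl
    refine ⟨?_, exists_incl_eq hm hτ b.rational u⟩
    rintro ⟨w, rfl⟩
    exact good_incl hm hτ w
  exact key _ (SystemOfFans.Omega.isFace h).le e

lemma nice_range_extend {a b : S.Omega} (h : a ≤ b) :
    κ.Nice (Set.range (extend h : TropChart κ a.cone → TropChart κ b.cone)) := by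
  obtain ⟨m, hm, e⟩ := SystemOfFans.Omega.isFace h
  have : Set.range (extend h : TropChart κ a.cone → TropChart κ b.cone) =
      (fun u : TropChart κ b.cone => u.coord ⟨m, hm⟩) ⁻¹' {r | κ.Good r} :=
    Set.ext (mem_range_extend h hm e)
  rw [this]
  exact κ.nice_good.preimage (continuous_coord _)

end TropChart

variable (κ S) in
/-- Two points of charts are identified in the tropical toric prevariety if they come from a
common smaller chart. -/
def TropEqv (p q : Σ ω : S.Omega, TropChart κ ω.cone) : Prop :=
  ∃ (d : S.Omega) (hp : d ≤ p.1) (hq : d ≤ q.1) (w : TropChart κ d.cone),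
    w.extend hp = p.2 ∧ w.extend hq = q.2

/-- Only transitivity has content. A point of the middle chart that comes from two faces, cut out by
`m` and `m'`, comes from their intersection, because its coordinate at `m + m'` is a product of
`Good` values. Injectivity of `extend` then matches the representatives. -/
lemma tropEqv_equivalence : Equivalence (TropEqv κ S) where
  refl p := ⟨p.1, le_rfl, le_rfl, p.2, rfl, rfl⟩
  symm := fun ⟨d, hp, hq, w, h, h'⟩ => ⟨d, hq, hp, w, h', h⟩
  trans := by
    rintro p q r ⟨d, hp, hq, w, h1, h2⟩ ⟨e, hq', hr, w', h3, h4⟩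
    obtain ⟨c, hcd, hce, hc⟩ := SystemOfFans.Omega.inf_of_le hq hq'
    obtain ⟨m, hm, hd⟩ := SystemOfFans.Omega.isFace hq
    obtain ⟨m', hm', he⟩ := SystemOfFans.Omega.isFace hq'
    obtain ⟨m'', hm'', hc'⟩ := SystemOfFans.Omega.isFace hcd
    obtain ⟨v, hv⟩ : ∃ v : TropChart κ c.cone, v.extend (hcd.trans hq) = q.2 := by
      -- Both `m` and `m'` are nonnegative on the cone, so their sum vanishes exactly where both do.
      have hce : c.cone = faceOf q.1.cone (m + m') := by
        rw [hc, hd, he]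
        apply le_antisymm
        · intro v hv
          exact ⟨hv.1.1, (pairing_add_left m m' v).trans (by rw [hv.1.2, hv.2.2, add_zero])⟩
        · intro v hv
          have := (pairing_add_left m m' v).symm.trans hv.2
          have h1 := hm v hv.1
          have h2 := hm' v hv.1
          exact ⟨⟨hv.1, by linarith⟩, ⟨hv.1, by linarith⟩⟩
      refine (TropChart.mem_range_extend (hcd.trans hq) (add_mem hm hm') hce q.2).2 ?_
      have g1 := (TropChart.mem_range_extend hq hm hd q.2).1 ⟨w, h2⟩
      have g2 := (TropChart.mem_range_extend hq' hm' he q.2).1 ⟨w', h3⟩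
      have := q.2.coord_add ⟨m, hm⟩ ⟨m', hm'⟩
      change κ.Good (q.2.coord (⟨m, hm⟩ + ⟨m', hm'⟩))
      rw [this]
      exact Kind.Good.mul g1 g2
    have e1 : v.extend hcd = w := TropChart.extend_injective hq (hv.trans h2.symm)
    have e2 : v.extend hce = w' := TropChart.extend_injective hq' (hv.trans h3.symm)
    refine ⟨c, hcd.trans hp, hce.trans hr, v, ?_, ?_⟩
    · rw [← h1, ← e1]; rfl
    · rw [← h4, ← e2]; rfl

namespace TropSpace

/-- The inclusion of the chart `U_[σ,i]^trop` into `X^trop`. -/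
def mk (ω : S.Omega) (u : TropChart κ ω.cone) : TropSpace κ S := Quot.mk _ ⟨ω, u⟩

lemma mk_extend {a b : S.Omega} (h : a ≤ b) (u : TropChart κ a.cone) :
    mk b (u.extend h) = mk a u :=
  (Quot.sound ⟨h, rfl⟩).symm

/-- The quotient is by the equivalence relation generated by `TropRel`, and `TropEqv` is already an
equivalence relation containing it. So no zigzags are needed. -/
lemma mk_eq_mk {a b : S.Omega} {u : TropChart κ a.cone} {v : TropChart κ b.cone} :
    mk a u = mk b v ↔ ∃ (d : S.Omega) (ha : d ≤ a) (hb : d ≤ b) (w : TropChart κ d.cone),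
      w.extend ha = u ∧ w.extend hb = v := by
  constructor
  · intro h
    have hle : ∀ p q, TropRel κ S p q → TropEqv κ S p q := fun p q ⟨h, e⟩ =>
      ⟨p.1, le_rfl, h, p.2, rfl, e.symm⟩
    exact tropEqv_equivalence.eqvGen_iff.1 (Relation.EqvGen.mono hle _ _ (Quot.eqvGen_exact h))
  · rintro ⟨d, ha, hb, w, rfl, rfl⟩
    rw [mk_extend, mk_extend]

lemma mk_injective (ω : S.Omega) : Function.Injective (mk ω : TropChart κ ω.cone → _) := by
  intro u v h
  obtain ⟨d, ha, hb, w, rfl, rfl⟩ := mk_eq_mk.1 h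
  rfl

lemma continuous_mk (ω : S.Omega) : Continuous (mk ω : TropChart κ ω.cone → TropSpace κ S) :=
  continuous_quot_mk.comp (continuous_sigmaMk (σ := fun ω : S.Omega => TropChart κ ω.cone))

lemma nice_iff {s : Set (TropSpace κ S)} : κ.Nice s ↔ ∀ ω : S.Omega, κ.Nice (mk ω ⁻¹' s) := by
  refine ⟨fun h ω => h.preimage (continuous_mk ω), fun h => ?_⟩
  cases κ with
  | full =>
    exact isQuotientMap_quot_mk.isOpen_preimage.1 (isOpen_sigma_iff.2 h)
  | nonneg =>
    exact isQuotientMap_quot_mk.isClosed_preimage.1 (isClosed_sigma_iff.2 h)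

/-- Seen in a chart `ω'`, the image is the finite union, over common smaller charts `d`, of the
images of the parts of `s` in `d`. Each is `Nice` because `d` embeds in `ω'` with `Nice` range. -/
lemma Nice.image_mk {ω : S.Omega} {s : Set (TropChart κ ω.cone)} (hs : κ.Nice s) :
    κ.Nice (mk ω '' s) := by
  refine nice_iff.2 fun ω' => ?_
  have : mk ω' ⁻¹' (mk ω '' s) = ⋃ d : {d : S.Omega // d ≤ ω ∧ d ≤ ω'},
      TropChart.extend d.2.2 '' (TropChart.extend d.2.1 ⁻¹' s) := by
    ext u
    simp only [Set.mem_preimage, Set.mem_image, Set.mem_iUnion]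
    constructor
    · rintro ⟨v, hv, h⟩
      obtain ⟨d, ha, hb, w, rfl, rfl⟩ := mk_eq_mk.1 h
      exact ⟨⟨d, ha, hb⟩, w, hv, rfl⟩
    · rintro ⟨⟨d, ha, hb⟩, w, hw, rfl⟩
      exact ⟨_, hw, by rw [mk_extend, mk_extend]⟩
  rw [this]
  exact κ.nice_iUnion fun d => (hs.preimage (TropChart.isInducing_extend _).continuous).image
    (TropChart.isInducing_extend _) (TropChart.nice_range_extend _)

lemma nice_range_mk (ω : S.Omega) :
    κ.Nice (Set.range (mk ω : TropChart κ ω.cone → TropSpace κ S)) := by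
  rw [← Set.image_univ]
  refine Nice.image_mk ?_
  cases κ with
  | full => exact isOpen_univ
  | nonneg => exact isClosed_univ

lemma isInducing_mk (ω : S.Omega) : IsInducing (mk ω : TropChart κ ω.cone → TropSpace κ S) :=
  Kind.isInducing_of_nice_image (κ := κ) (continuous_mk ω) (mk_injective ω)
    fun _ h => Nice.image_mk h

end TropSpace
end tropSpace

/-! ### Regular functions on affine charts of a scheme. -/

section spec

variable {X X' : Scheme.{u}} {A A' : CommRingCat.{u}} (c : Spec A ⟶ X) (c' : Spec A' ⟶ X')

/-- The pullback of regular functions to an affine scheme. -/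
noncomputable def pull (U : X.Opens) (h : ⊤ ≤ c ⁻¹ᵁ U) : Γ(X, U) ⟶ A :=
  c.appLE U ⊤ h ≫ (Scheme.ΓSpecIso A).hom

/-- The regular functions on the image of an affine chart. -/
noncomputable def sec [IsOpenImmersion c] : A ⟶ Γ(X, c ''ᵁ ⊤) :=
  (Scheme.ΓSpecIso A).inv ≫ (c.appIso ⊤).inv

lemma top_le_preimage_image [IsOpenImmersion c] : ⊤ ≤ c ⁻¹ᵁ c ''ᵁ ⊤ :=
  (Scheme.Hom.preimage_image_eq c ⊤).ge

lemma sec_pull [IsOpenImmersion c] : sec c ≫ pull c (c ''ᵁ ⊤) (top_le_preimage_image c) = 𝟙 A := by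
  rw [sec, pull, ← Scheme.Hom.appIso_hom', Category.assoc, Iso.inv_hom_id_assoc, Iso.inv_hom_id]

lemma pull_sec [IsOpenImmersion c] (U : X.Opens) (h : ⊤ ≤ c ⁻¹ᵁ U) (h' : c ''ᵁ ⊤ ≤ U) :
    pull c U h ≫ sec c = X.presheaf.map (homOfLE h').op := by
  rw [pull, sec, Category.assoc, Iso.hom_inv_id_assoc, Scheme.Hom.appLE_appIso_inv]

-- Naturality of `pull` in a commutative square; it turns identities of morphisms on charts into
-- identities of ring homomorphisms.
variable {c c'} in
lemma appLE_pull {φ : X ⟶ X'} {ψ : A' ⟶ A} (e : c ≫ φ = Spec.map ψ ≫ c') (U' : X'.Opens)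
    (U : X.Opens) (h : ⊤ ≤ c ⁻¹ᵁ U) (h' : ⊤ ≤ c' ⁻¹ᵁ U') (hU : U ≤ φ ⁻¹ᵁ U') :
    φ.appLE U' U hU ≫ pull c U h = pull c' U' h' ≫ ψ := by
  rw [pull, pull, Category.assoc, ← Scheme.ΓSpecIso_naturality, ← Category.assoc,
    Scheme.Hom.appLE_comp_appLE, ← Category.assoc]
  congr 1
  have : (Spec.map ψ).appTop = (Spec.map ψ).appLE ⊤ ⊤ le_rfl := Scheme.Hom.app_eq_appLE _
  rw [this]
  refine Eq.trans ?_ (Scheme.Hom.appLE_comp_appLE (Spec.map ψ) c' U' ⊤ ⊤ h' le_rfl).symm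
  simp only [e]

lemma mem_basicOpen_sec [IsOpenImmersion c] (f : A) (z : Spec A) :
    c z ∈ X.basicOpen (sec c f) ↔ f ∉ z.asIdeal := by
  have h : X.basicOpen (sec c f) = c ''ᵁ (Spec A).basicOpen ((Scheme.ΓSpecIso A).inv f) :=
    (Scheme.image_basicOpen c _).symm
  rw [h, basicOpen_eq_of_affine]
  refine ⟨?_, fun hf => ⟨z, hf, rfl⟩⟩
  rintro ⟨z', hz', e⟩
  rwa [← c.isOpenEmbedding.injective e]

end spec

/-! ### Charts of a toric prevariety and absolute values on them. -/

section chart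

variable {κ : Kind} {S : SystemOfFans} {k : Type u} [CommRing k]

lemma chart_map {a b : S.Omega} (h : a ≤ b) :
    Spec.map (CommRingCat.ofHom (chartRingHom k (SystemOfFans.Omega.isFace h).le)) ≫ chart k S b =
      chart k S a :=
  colimit.w (chartFunctor k S) (homOfLE h)

lemma chart_image_le {a b : S.Omega} (h : a ≤ b) : chart k S a ''ᵁ ⊤ ≤ chart k S b ''ᵁ ⊤ := by
  rintro _ ⟨z, -, rfl⟩
  refine ⟨Spec.map (CommRingCat.ofHom (chartRingHom k (SystemOfFans.Omega.isFace h).le)) z,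
    trivial, ?_⟩
  rw [← chart_map h]
  rfl

lemma mem_chart_iff {ω : S.Omega} {x : (toricPrevariety k S).left} :
    x ∈ chart k S ω ''ᵁ ⊤ ↔ ∃ z, chart k S ω z = x :=
  ⟨fun ⟨z, _, h⟩ => ⟨z, h⟩, fun ⟨z, h⟩ => ⟨z, trivial, h⟩⟩

/-- The diagram of charts is locally directed, so two charts are glued only along smaller charts of
the diagram. -/
lemma exists_mem_chart_of_mem {a b : S.Omega} {x : (toricPrevariety k S).left}
    (ha : x ∈ chart k S a ''ᵁ ⊤) (hb : x ∈ chart k S b ''ᵁ ⊤) :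
    ∃ d, d ≤ a ∧ d ≤ b ∧ x ∈ chart k S d ''ᵁ ⊤ := by
  obtain ⟨za, ha⟩ := mem_chart_iff.1 ha
  obtain ⟨zb, hb⟩ := mem_chart_iff.1 hb
  obtain ⟨d, fa, fb, z, h1, -⟩ := (Scheme.IsLocallyDirected.ι_eq_ι_iff (chartFunctor k S)).1
    (ha.trans hb.symm)
  refine ⟨d, fa.le, fb.le, mem_chart_iff.2 ⟨z, ?_⟩⟩
  rw [← ha, ← chart_map fa.le, ← h1]
  rfl

/-- The face chart of `τ = σ ∩ m^⊥` is the locus where `χ^m` is invertible. -/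
lemma mem_chart_face {a b : S.Omega} (h : a ≤ b) {m : Fin S.rank → ℤ}
    (hm : m ∈ dualMonoid b.cone) (e : a.cone = faceOf b.cone m)
    (z : PrimeSpectrum (AddMonoidAlgebra k (dualMonoid b.cone))) :
    chart k S b z ∈ chart k S a ''ᵁ ⊤ ↔ chi k (⟨m, hm⟩ : dualMonoid b.cone) ∉ z.asIdeal := by
  rw [← (chart_face k b.rational hm e (SystemOfFans.Omega.isFace h).le).2 z, mem_chart_iff]
  refine exists_congr fun w => ?_
  rw [← chart_map h]
  exact (chart k S b).isOpenEmbedding.injective.eq_iff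

variable [Norm k]

lemma chartEval_eq_eval_sec (x : AnPoint κ (toricPrevariety k S)) (ω : S.Omega)
    (hx : x.pt ∈ chart k S ω ''ᵁ ⊤) (f : AddMonoidAlgebra k (dualMonoid ω.cone)) :
    chartEval x ω hx f = x.eval _ hx (sec (chart k S ω) f) := rfl

lemma eval_eq_chartEval (x : AnPoint κ (toricPrevariety k S)) {ω : S.Omega}
    (hx : x.pt ∈ chart k S ω ''ᵁ ⊤) {U : (toricPrevariety k S).left.Opens}
    (h : ⊤ ≤ chart k S ω ⁻¹ᵁ U) (h' : chart k S ω ''ᵁ ⊤ ≤ U)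
    (g : Γ((toricPrevariety k S).left, U)) :
    x.eval U (h' hx) g = chartEval x ω hx (pull (chart k S ω) U h g) := by
  rw [chartEval_eq_eval_sec, ← x.eval_map (homOfLE h') hx, ← pull_sec (chart k S ω) U h h']
  rfl

lemma good_chartEval_iff (x : AnPoint κ (toricPrevariety k S)) {ω : S.Omega}
    (hx : x.pt ∈ chart k S ω ''ᵁ ⊤) {z : PrimeSpectrum (AddMonoidAlgebra k (dualMonoid ω.cone))}
    (hz : chart k S ω z = x.pt) (f : AddMonoidAlgebra k (dualMonoid ω.cone)) :
    κ.Good (chartEval x ω hx f) ↔ f ∉ z.asIdeal := by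
  rw [chartEval_eq_eval_sec, x.good_eval_iff, ← hz]
  exact mem_basicOpen_sec (chart k S ω) f z

lemma chartEval_map {S' : SystemOfFans} {φ : toricPrevariety k S ⟶ toricPrevariety k S'}
    {ω : S.Omega} {ω' : S'.Omega}
    {ψ : AddMonoidAlgebra k (dualMonoid ω'.cone) →+* AddMonoidAlgebra k (dualMonoid ω.cone)}
    (e : chart k S ω ≫ φ.left = Spec.map (CommRingCat.ofHom ψ) ≫ chart k S' ω')
    (x : AnPoint κ (toricPrevariety k S)) (hx : x.pt ∈ chart k S ω ''ᵁ ⊤)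
    (hx' : (x.map φ).pt ∈ chart k S' ω' ''ᵁ ⊤) (f : AddMonoidAlgebra k (dualMonoid ω'.cone)) :
    chartEval (x.map φ) ω' hx' f = chartEval x ω hx (ψ f) := by
  have hle : chart k S ω ''ᵁ ⊤ ≤ φ.left ⁻¹ᵁ chart k S' ω' ''ᵁ ⊤ := by
    rintro _ ⟨z, -, rfl⟩
    refine mem_chart_iff.2 ⟨Spec.map (CommRingCat.ofHom ψ) z, ?_⟩
    rw [← Scheme.Hom.comp_apply, ← e]
    rfl
  rw [chartEval_eq_eval_sec, x.map_eval φ hle hx,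
    eval_eq_chartEval x hx (top_le_preimage_image _) le_rfl]
  refine congrArg (chartEval x ω hx) ?_
  have h1 := appLE_pull e _ _ (top_le_preimage_image _) (top_le_preimage_image _) hle
  have h2 := sec_pull (chart k S' ω')
  have h3 : sec (chart k S' ω') ≫ φ.left.appLE _ _ hle ≫ pull (chart k S ω) _
      (top_le_preimage_image _) = CommRingCat.ofHom ψ := by
    rw [h1, ← Category.assoc, h2, Category.id_comp]
  exact congr($h3 f)

lemma chartEval_algebraMap (x : AnPoint κ (toricPrevariety k S)) {ω : S.Omega}
    (hx : x.pt ∈ chart k S ω ''ᵁ ⊤) (a : k) : chartEval x ω hx (algebraMap k _ a) = ‖a‖ := by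
  rw [← x.eval_const hx a, eval_eq_chartEval x hx (top_le_preimage_image _) le_rfl]
  refine congrArg (chartEval x ω hx) ?_
  have h1 := appLE_pull (c' := 𝟙 (Spec (.of k))) (φ := (toricPrevariety k S).hom)
    (c := chart k S ω) (ψ := CommRingCat.ofHom (algebraMap k _))
    (by rw [chart_comp_hom, Category.comp_id]) ⊤ (chart k S ω ''ᵁ ⊤)
    (top_le_preimage_image _) le_rfl le_top
  have h2 : (Scheme.ΓSpecIso (.of k)).inv ≫ pull (𝟙 (Spec (.of k))) ⊤ le_rfl = 𝟙 _ := by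
    have h : (𝟙 (Spec (.of k)) : Spec (.of k) ⟶ _).appLE ⊤ ⊤ le_rfl = 𝟙 _ :=
      (Scheme.Hom.app_eq_appLE _).symm.trans (Scheme.Hom.id_app _)
    change _ ≫ (𝟙 (Spec (.of k)) : Spec (.of k) ⟶ _).appLE ⊤ ⊤ le_rfl ≫ _ = _
    rw [h, Category.id_comp, Iso.inv_hom_id]
  have h3 : (Scheme.ΓSpecIso (.of k)).inv ≫ (toricPrevariety k S).hom.appLE ⊤
      (chart k S ω ''ᵁ ⊤) le_top ≫ pull (chart k S ω) _ (top_le_preimage_image _) =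
        CommRingCat.ofHom (algebraMap k _) := by
    rw [h1, ← Category.assoc, h2, Category.id_comp]
  exact congr($h3 a).symm

end chart

/-! ### Torus-invariant open subsets and homogeneous ideals. -/

section graded

variable {k : Type u} [CommRing k] {n : ℕ} {s : AddSubmonoid (Fin n → ℤ)}

/-- For an ideal `q` of `k[S]` the homomorphism `k[M × S] → (k[S]/q)[M]`. -/
noncomputable def gradedQuotient (q : Ideal (AddMonoidAlgebra k s)) :
    AddMonoidAlgebra k ((Fin n → ℤ) × s) →ₐ[k]
      AddMonoidAlgebra (AddMonoidAlgebra k s ⧸ q) (Fin n → ℤ) :=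
  AddMonoidAlgebra.lift k _ _
    { toFun := fun p => AddMonoidAlgebra.single p.toAdd.1
        (Ideal.Quotient.mk q (AddMonoidAlgebra.single p.toAdd.2 1))
      map_one' := by
        change AddMonoidAlgebra.single 0 (Ideal.Quotient.mk q 1) = _
        rw [map_one]; rfl
      map_mul' := fun p p' => by
        rw [AddMonoidAlgebra.single_mul_single, ← map_mul, AddMonoidAlgebra.single_mul_single,
          one_mul]
        rfl }

lemma gradedQuotient_single (q : Ideal (AddMonoidAlgebra k s)) (m : Fin n → ℤ) (t : s) (c : k) :
    gradedQuotient q (AddMonoidAlgebra.single (m, t) c) =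
      AddMonoidAlgebra.single m (Ideal.Quotient.mk q (AddMonoidAlgebra.single t c)) := by
  rw [gradedQuotient, AddMonoidAlgebra.lift_single]
  change c • AddMonoidAlgebra.single m (Ideal.Quotient.mk q (AddMonoidAlgebra.single t 1)) = _
  rw [AddMonoidAlgebra.smul_single]
  congr 1
  rw [← Ideal.Quotient.mkₐ_eq_mk k, ← map_smul, AddMonoidAlgebra.smul_single, smul_eq_mul, mul_one]

lemma gradedQuotient_inr (q : Ideal (AddMonoidAlgebra k s)) (f : AddMonoidAlgebra k s) :
    gradedQuotient q (AddMonoidAlgebra.mapDomainRingHom k (AddMonoidHom.inr (Fin n → ℤ) s) f) =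
      AddMonoidAlgebra.single 0 (Ideal.Quotient.mk q f) := by
  induction f using AddMonoidAlgebra.induction_linear with
  | zero => simp
  | add x y hx hy => rw [map_add, map_add, hx, hy, map_add, AddMonoidAlgebra.single_add]
  | single t c =>
    rw [AddMonoidAlgebra.mapDomainRingHom_apply, AddMonoidAlgebra.mapDomain_single]
    exact gradedQuotient_single q 0 t c

-- Pullback along the action places the term at `s` in degree `s`. Therefore the pullback of `f` is
-- killed exactly when every term of `f` lies in `q`.
open Classical in
lemma coeff_gradedQuotient_diag (q : Ideal (AddMonoidAlgebra k s)) (f : AddMonoidAlgebra k s)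
    (m : Fin n → ℤ) :
    (gradedQuotient q (AddMonoidAlgebra.mapDomainRingHom k
      (s.subtype.prod (AddMonoidHom.id s)) f)).coeff m =
      if h : m ∈ s then
        Ideal.Quotient.mk q (AddMonoidAlgebra.single ⟨m, h⟩ (f.coeff ⟨m, h⟩)) else 0 := by
  induction f using AddMonoidAlgebra.induction_linear with
  | zero => simp
  | add x y hx hy =>
    rw [map_add, map_add, AddMonoidAlgebra.coeff_add, Finsupp.add_apply, hx, hy]
    split_ifs with h
    · rw [AddMonoidAlgebra.coeff_add, Finsupp.add_apply, AddMonoidAlgebra.single_add, map_add]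
    · rw [add_zero]
  | single t c =>
    rw [AddMonoidAlgebra.mapDomainRingHom_apply, AddMonoidAlgebra.mapDomain_single]
    have e : (s.subtype.prod (AddMonoidHom.id s)) t = (t.1, t) := rfl
    rw [e, gradedQuotient_single, AddMonoidAlgebra.coeff_single, Finsupp.single_apply]
    by_cases h : t.1 = m
    · subst h
      rw [if_pos rfl, dif_pos t.2, AddMonoidAlgebra.coeff_single, Finsupp.single_eq_same]
    · rw [if_neg h]
      split_ifs with hm
      · rw [AddMonoidAlgebra.coeff_single, Finsupp.single_apply,
          if_neg (fun h' => h (congrArg Subtype.val h')), AddMonoidAlgebra.single_zero, map_zero]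
      · rfl

/-- If the preimages of an open set `U` of `Spec k[S]` under the action of the torus and under the
projection agree, then membership of `p` in `U` passes to all `q` such that every term of a
polynomial lies in `p` if it lies in `q`. -/
lemma mem_of_terms_mem {U : TopologicalSpace.Opens (PrimeSpectrum (AddMonoidAlgebra k s))}
    (hU : ∀ P : PrimeSpectrum (AddMonoidAlgebra k ((Fin n → ℤ) × s)),
      PrimeSpectrum.comap (AddMonoidAlgebra.mapDomainRingHom k
        (s.subtype.prod (AddMonoidHom.id s))) P ∈ U ↔
      PrimeSpectrum.comap (AddMonoidAlgebra.mapDomainRingHom k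
        (AddMonoidHom.inr (Fin n → ℤ) s)) P ∈ U)
    {p q : PrimeSpectrum (AddMonoidAlgebra k s)} (hp : p ∈ U)
    (hpq : ∀ t c, AddMonoidAlgebra.single t c ∈ q.asIdeal →
      AddMonoidAlgebra.single t c ∈ p.asIdeal) : q ∈ U := by
  -- The generic point of `T × {p}`. Its ideal is prime because `(k[S]/p)[M]` is a domain; it
  -- projects to `p`, and the action sends it to the prime of those `f` all of whose terms lie in
  -- `p`.
  let P (p : PrimeSpectrum (AddMonoidAlgebra k s)) :
      PrimeSpectrum (AddMonoidAlgebra k ((Fin n → ℤ) × s)) :=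
    ⟨RingHom.ker (gradedQuotient p.asIdeal).toRingHom, RingHom.ker_isPrime _⟩
  have h1 : ∀ p, PrimeSpectrum.comap (AddMonoidAlgebra.mapDomainRingHom k
        (AddMonoidHom.inr (Fin n → ℤ) s)) (P p) = p := by
    intro p
    ext f
    change gradedQuotient p.asIdeal _ = 0 ↔ _
    rw [gradedQuotient_inr, AddMonoidAlgebra.single_eq_zero, Ideal.Quotient.eq_zero_iff_mem]
  have h2 : ∀ p, PrimeSpectrum.comap (AddMonoidAlgebra.mapDomainRingHom k
        (s.subtype.prod (AddMonoidHom.id s))) (P p) ∈ U ↔ p ∈ U := fun p => by rw [hU, h1]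
  rw [← h2] at hp ⊢
  -- By hypothesis the image of `P q` under the action is a generization of that of `P p`, and open
  -- sets are stable under generization.
  refine (((PrimeSpectrum.le_iff_specializes _ _).1 ?_).mem_open U.2 hp)
  intro f hf
  replace hf : gradedQuotient q.asIdeal _ = 0 := hf
  change gradedQuotient p.asIdeal _ = 0
  ext m
  have hm := coeff_gradedQuotient_diag q.asIdeal f m
  rw [hf] at hm
  rw [coeff_gradedQuotient_diag]
  split_ifs at hm ⊢ with h
  · exact Ideal.Quotient.eq_zero_iff_mem.2 (hpq _ _ (Ideal.Quotient.eq_zero_iff_mem.1 hm.symm))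
  · rfl

end graded

/-! ### Tropicalization in charts. -/

section chart

variable {κ : Kind} {S : SystemOfFans} {k : Type u} [CommRing k]

lemma chart_toScheme {S' : SystemOfFans} (φ : ToricHom S S') (ω : S.Omega) :
    chart k S ω ≫ (φ.toScheme k).left =
      Spec.map (CommRingCat.ofHom (AddMonoidAlgebra.mapDomainRingHom k (φ.dual ω))) ≫
        chart k S' (φ.onOmega ω) :=
  colimit.ι_desc _ _

lemma single_eq_algebraMap_mul_chi {n : ℕ} {σ : Cone n} (s : dualMonoid σ) (c : k) :
    AddMonoidAlgebra.single s c = algebraMap k (AddMonoidAlgebra k (dualMonoid σ)) c * chi k s := by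
  rw [← Algebra.smul_def, chi, AddMonoidAlgebra.smul_single, smul_eq_mul, mul_one]

lemma finite_faces (ω : S.Omega) : {τ | IsFace τ ω.cone}.Finite := by
  induction ω using Quotient.inductionOn with
  | h p => exact (S.fan _ _).finite.subset fun τ hτ => (S.fan _ _).face_mem _ p.2 τ hτ

lemma exists_le_cone_eq (ω : S.Omega) {τ : Cone S.rank} (h : IsFace τ ω.cone) :
    ∃ d ≤ ω, d.cone = τ := by
  induction ω using Quotient.inductionOn with
  | h p =>
    have hτ := (S.fan _ _).face_mem _ p.2 τ h
    exact ⟨SystemOfFans.cls τ p.1.2 hτ, ⟨p.1.2, τ, p.1.1, hτ, p.2, rfl, rfl, h⟩, rfl⟩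

variable [Norm k]

lemma AnPoint.map_map {Y X Z : Over (Spec (CommRingCat.of k))} (y : AnPoint κ Y) (f : Y ⟶ X)
    (g : X ⟶ Z) : (y.map f).map g = y.map (f ≫ g) := by
  obtain ⟨_, ⟨U, hU, rfl⟩, hy, -⟩ := Z.left.isBasis_affineOpens.exists_subset_of_mem_open
    (show ((y.map f).map g).pt ∈ Set.univ from trivial) isOpen_univ
  refine AnPoint.ext_of_eval hU hy hy fun h => ?_
  rw [(y.map f).map_eval g (le_refl (g.left ⁻¹ᵁ U)) hy,
    y.map_eval f (le_refl (f.left ⁻¹ᵁ g.left ⁻¹ᵁ U)) hy,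
    y.map_eval (f ≫ g) (le_refl (f.left ⁻¹ᵁ g.left ⁻¹ᵁ U)) hy]
  refine congrArg (y.eval _ hy) ?_
  exact congr($(Scheme.Hom.appLE_comp_appLE f.left g.left U (g.left ⁻¹ᵁ U)
    (f.left ⁻¹ᵁ g.left ⁻¹ᵁ U) le_rfl le_rfl) h)

lemma tropChart_coord (x : AnPoint κ (toricPrevariety k S)) {ω : S.Omega}
    (hx : x.pt ∈ chart k S ω ''ᵁ ⊤) (s : dualMonoid ω.cone) :
    (tropChart x ω hx).coord s = chartEval x ω hx (chi k s) :=
  expNeg_negLog (chartEval_nonneg x ω hx _)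

lemma chartEval_of_le (x : AnPoint κ (toricPrevariety k S)) {a b : S.Omega} (h : a ≤ b)
    (ha : x.pt ∈ chart k S a ''ᵁ ⊤) (f : AddMonoidAlgebra k (dualMonoid b.cone)) :
    chartEval x b (chart_image_le h ha) f =
      chartEval x a ha (chartRingHom k (SystemOfFans.Omega.isFace h).le f) := by
  have hle : ⊤ ≤ chart k S a ⁻¹ᵁ chart k S b ''ᵁ ⊤ :=
    (top_le_preimage_image _).trans fun z hz => chart_image_le h hz
  rw [chartEval_eq_eval_sec, eval_eq_chartEval x ha hle (chart_image_le h)]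
  refine congrArg (chartEval x a ha) ?_
  have h1 := appLE_pull (c := chart k S a) (c' := chart k S b) (φ := 𝟙 _)
    (ψ := CommRingCat.ofHom (chartRingHom k (SystemOfFans.Omega.isFace h).le))
    (by rw [chart_map h, Category.comp_id]) (chart k S b ''ᵁ ⊤) (chart k S b ''ᵁ ⊤) hle
    (top_le_preimage_image _) le_rfl
  have h0 : (𝟙 (toricPrevariety k S).left : _ ⟶ _).appLE (chart k S b ''ᵁ ⊤)
      (chart k S b ''ᵁ ⊤) le_rfl = 𝟙 _ :=
    (Scheme.Hom.app_eq_appLE _).symm.trans (Scheme.Hom.id_app _)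
  have h2 : sec (chart k S b) ≫ pull (chart k S a) _ hle =
      CommRingCat.ofHom (chartRingHom k (SystemOfFans.Omega.isFace h).le) := by
    rw [h0, Category.id_comp] at h1
    rw [h1, ← Category.assoc, sec_pull, Category.id_comp]
  exact congr($h2 f)

lemma tropChart_extend (x : AnPoint κ (toricPrevariety k S)) {a b : S.Omega} (h : a ≤ b)
    (ha : x.pt ∈ chart k S a ''ᵁ ⊤) :
    (tropChart x a ha).extend h = tropChart x b (chart_image_le h ha) := by
  refine TropChart.ext_coord fun s => ?_
  rw [tropChart_coord, chartEval_of_le x h ha, chi, chartRingHom_single]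
  exact tropChart_coord x ha _

/-- Independence of the chart chosen in `trop`: two charts around the center share a smaller one
around it, and `tropChart` is compatible with face inclusions. -/
lemma trop_eq_mk (x : AnPoint κ (toricPrevariety k S)) {ω : S.Omega}
    (hx : x.pt ∈ chart k S ω ''ᵁ ⊤) : trop x = TropSpace.mk ω (tropChart x ω hx) := by
  change TropSpace.mk _ (tropChart x _ (exists_mem_chart k S x.pt).choose_spec) = _
  obtain ⟨d, h1, h2, hd⟩ := exists_mem_chart_of_mem (exists_mem_chart k S x.pt).choose_spec hx
  rw [← tropChart_extend x h1 hd, ← tropChart_extend x h2 hd, TropSpace.mk_extend,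
    TropSpace.mk_extend]

/-- The tropicalization remembers which charts contain the center: a face chart is cut out
tropically by a `Good` coordinate at `m`, which says that `χ^m` is invertible at the center. -/
lemma mem_chart_of_trop_eq_mk {x : AnPoint κ (toricPrevariety k S)} {ω : S.Omega}
    {u : TropChart κ ω.cone} (h : trop x = TropSpace.mk ω u) : x.pt ∈ chart k S ω ''ᵁ ⊤ := by
  obtain ⟨ω', hx⟩ := exists_mem_chart k S x.pt
  rw [trop_eq_mk x hx, TropSpace.mk_eq_mk] at h
  obtain ⟨d, h1, h2, w, hw, -⟩ := h
  refine chart_image_le h2 ?_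
  obtain ⟨m, hm, e⟩ := SystemOfFans.Omega.isFace h1
  have hg := (TropChart.mem_range_extend h1 hm e _).1 ⟨w, hw⟩
  obtain ⟨z, hz⟩ := mem_chart_iff.1 hx
  rw [← hz]
  refine (mem_chart_face h1 hm e z).2 ?_
  rw [tropChart_coord] at hg
  exact (good_chartEval_iff x hx hz _).1 hg

lemma trop_mem_range_mk {x : AnPoint κ (toricPrevariety k S)} {ω : S.Omega} :
    trop x ∈ Set.range (TropSpace.mk ω : TropChart κ ω.cone → TropSpace κ S) ↔
      x.pt ∈ chart k S ω ''ᵁ ⊤ :=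
  ⟨fun ⟨_, h⟩ => mem_chart_of_trop_eq_mk h.symm, fun h => ⟨_, (trop_eq_mk x h).symm⟩⟩

lemma tropMap_trop {S' : SystemOfFans} (φ : ToricHom S S')
    (x : AnPoint κ (toricPrevariety k S)) :
    tropMap φ (trop x) = trop (x.map (φ.toScheme k)) := by
  obtain ⟨ω, hx⟩ := exists_mem_chart k S x.pt
  have hx' : (x.map (φ.toScheme k)).pt ∈ chart k S' (φ.onOmega ω) ''ᵁ ⊤ := by
    obtain ⟨z, hz⟩ := mem_chart_iff.1 hx
    refine mem_chart_iff.2 ⟨Spec.map (CommRingCat.ofHom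
      (AddMonoidAlgebra.mapDomainRingHom k (φ.dual ω))) z, ?_⟩
    rw [← Scheme.Hom.comp_apply, ← chart_toScheme, Scheme.Hom.comp_apply, hz]
    rfl
  rw [trop_eq_mk x hx, trop_eq_mk _ hx']
  refine congrArg (TropSpace.mk (φ.onOmega ω)) (TropChart.ext_coord fun s => ?_)
  rw [tropChart_coord, chartEval_map (chart_toScheme φ ω) x hx hx', chi,
    AddMonoidAlgebra.mapDomainRingHom_apply, AddMonoidAlgebra.mapDomain_single]
  exact tropChart_coord x hx (φ.dual ω s)

/-- A monomial on `U` is a monomial on each chart that is contained in `U`. -/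
lemma IsMonomial.eval_eq {U : (toricPrevariety k S).left.Opens}
    {g : Γ((toricPrevariety k S).left, U)} (hg : IsMonomial g) :
    ∃ (a : k) (m : Fin S.rank → ℤ), ∀ ω : S.Omega, chart k S ω ''ᵁ ⊤ ≤ U →
      ∃ hm : m ∈ dualMonoid ω.cone, ∀ (x : AnPoint κ (toricPrevariety k S)) (hxU : x.pt ∈ U)
        (hx : x.pt ∈ chart k S ω ''ᵁ ⊤),
        x.eval U hxU g = ‖a‖ * (tropChart x ω hx).coord ⟨m, hm⟩ := by
  obtain ⟨a, m, ha, h⟩ := hg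
  refine ⟨a, m, fun ω hω => ?_⟩
  have hle : ⊤ ≤ chart k S ω ⁻¹ᵁ U := (top_le_preimage_image _).trans fun z hz => hω hz
  have h1 : AddMonoidAlgebra.mapDomainRingHom k (dualMonoid ω.cone).subtype
      (pull (chart k S ω) U hle g) = AddMonoidAlgebra.single m a := by
    have hle' : ⊤ ≤ torusMap k ω ⁻¹ᵁ U := fun z _ => hle (show _ ∈ (⊤ : Set _) from trivial)
    have h2 := appLE_pull (c := torusMap k ω) (c' := chart k S ω) (φ := 𝟙 _)
      (ψ := CommRingCat.ofHom (AddMonoidAlgebra.mapDomainRingHom k (dualMonoid ω.cone).subtype))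
      (by rw [torusMap, Category.comp_id]) U U hle' hle le_rfl
    have h0 : (𝟙 (toricPrevariety k S).left : _ ⟶ _).appLE U U le_rfl = 𝟙 _ :=
      (Scheme.Hom.app_eq_appLE _).symm.trans (Scheme.Hom.id_app _)
    rw [h0, Category.id_comp] at h2
    refine Eq.trans (congr($h2 g).symm) ?_
    change (Scheme.ΓSpecIso _).hom ((Spec _).presheaf.map (homOfLE hle').op
      ((torusMap k ω).app U g)) = _
    rw [h ω]
    have h3 : (Scheme.ΓSpecIso (.of (AddMonoidAlgebra k (Fin S.rank → ℤ)))).inv ≫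
        (Spec _).presheaf.map (homOfLE (le_top : torusMap k ω ⁻¹ᵁ U ≤ ⊤)).op ≫
        (Spec _).presheaf.map (homOfLE hle').op ≫ (Scheme.ΓSpecIso _).hom = 𝟙 _ := by
      rw [← Functor.map_comp_assoc, ← op_comp]
      have : homOfLE hle' ≫ homOfLE (le_top : torusMap k ω ⁻¹ᵁ U ≤ ⊤) = 𝟙 ⊤ := rfl
      rw [this, op_id, CategoryTheory.Functor.map_id, Category.id_comp, Iso.inv_hom_id]
    exact congr($h3 (AddMonoidAlgebra.single m a))
  -- The restriction to the torus of a function on the chart is supported on `S_σ`, and its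
  -- coefficient `a` at `m` is nonzero.
  have hm : m ∈ dualMonoid ω.cone := by
    by_contra hm
    have h2 := congrArg (fun z => z.coeff m) h1
    simp only [AddMonoidAlgebra.mapDomainRingHom_apply, AddMonoidAlgebra.coeff_mapDomain,
      AddMonoidAlgebra.coeff_single, Finsupp.single_eq_same] at h2
    rw [Finsupp.mapDomain_of_notMem_range] at h2
    · exact ha h2.symm
    · rintro ⟨s, rfl⟩
      exact hm s.2
  have h2 : pull (chart k S ω) U hle g =
      AddMonoidAlgebra.single (⟨m, hm⟩ : dualMonoid ω.cone) a := by
    refine AddMonoidAlgebra.mapDomain_injective (f := (dualMonoid ω.cone).subtype)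
      Subtype.val_injective ?_
    rw [AddMonoidAlgebra.mapDomain_single]
    exact h1
  refine ⟨hm, fun x hxU hx => ?_⟩
  rw [eval_eq_chartEval x hx hle hω, h2, single_eq_algebraMap_mul_chi, chartEval_mul,
    chartEval_algebraMap, tropChart_coord]

/-- The center of a point of `X(S)^an` (resp. `X(S)^∘`) lies in a chart on which precisely the
characters in `τ^⊥` are invertible at the center. -/
lemma exists_minimal_chart (x : AnPoint κ (toricPrevariety k S)) :
    ∃ (d : S.Omega) (hd : x.pt ∈ chart k S d ''ᵁ ⊤), ∀ s : dualMonoid d.cone,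
      κ.Good (chartEval x d hd (chi k s)) → -s.1 ∈ dualMonoid d.cone := by
  obtain ⟨ω, hx⟩ := exists_mem_chart k S x.pt
  -- The faces whose chart contains the center; a minimal one is the cone wanted.
  let T : Set (Cone S.rank) := {τ | ∃ m, ∃ hm : m ∈ dualMonoid ω.cone,
    κ.Good (chartEval x ω hx (chi k ⟨m, hm⟩)) ∧ τ = faceOf ω.cone m}
  have hT : T.Finite := (finite_faces ω).subset fun τ ⟨m, hm, _, h⟩ => ⟨m, hm, h⟩
  have hT0 : T.Nonempty := ⟨_, 0, zero_mem _, by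
    have : chi k (⟨0, zero_mem _⟩ : dualMonoid ω.cone) = 1 := rfl
    rw [this, chartEval_one]
    exact κ.good_one, rfl⟩
  obtain ⟨τ, ⟨m, hm, hgood, e⟩, hmin⟩ := hT.exists_minimal hT0
  obtain ⟨d, hd, hdτ⟩ := exists_le_cone_eq ω ⟨m, hm, e⟩
  rw [e] at hdτ
  obtain ⟨z, hz⟩ := mem_chart_iff.1 hx
  have hxd : x.pt ∈ chart k S d ''ᵁ ⊤ := by
    rw [← hz]
    exact (mem_chart_face hd hm hdτ z).2 ((good_chartEval_iff x hx hz _).1 hgood)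
  refine ⟨d, hxd, fun s hs => ?_⟩
  have hs' : s.1 ∈ dualMonoid (faceOf ω.cone m) := hdτ ▸ s.2
  obtain ⟨p, hp⟩ := exists_add_nsmul_mem ω.rational hm hs'
  have hpm : s.1 + p • m + m ∈ dualMonoid ω.cone := add_mem hp hm
  have hle := (SystemOfFans.Omega.isFace hd).le
  -- The shift by `p • m` brings `s` into the dual monoid of the large cone, and the further summand
  -- `m` forces the face cut out to lie in `τ`.
  have hg : κ.Good (chartEval x ω hx (chi k ⟨s.1 + p • m + m, hpm⟩)) := by
    have e1 : chi k (⟨s.1 + p • m + m, hpm⟩ : dualMonoid ω.cone) =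
        chi k ⟨s.1 + p • m, hp⟩ * chi k ⟨m, hm⟩ := by
      rw [chi, chi, chi, AddMonoidAlgebra.single_mul_single, one_mul]
      rfl
    have e2 : chartRingHom k hle (chi k ⟨s.1 + p • m, hp⟩) =
        chi k s * (chartRingHom k hle (chi k ⟨m, hm⟩)) ^ p := by
      rw [chi, chi, chi, chartRingHom_single, chartRingHom_single, AddMonoidAlgebra.single_pow,
        AddMonoidAlgebra.single_mul_single, one_pow, one_mul]
      rfl
    rw [e1, chartEval_mul]
    refine Kind.Good.mul ?_ hgood
    rw [chartEval_of_le x hd hxd, e2, chartEval_mul]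
    refine Kind.Good.mul hs ?_
    rw [chartEval_of_le x hd hxd] at hgood
    have h1 : ∀ q : ℕ, κ.Good (chartEval x d hxd (chartRingHom k hle (chi k ⟨m, hm⟩) ^ q)) := by
      intro q
      induction q with
      | zero => rw [pow_zero, chartEval_one]; exact κ.good_one
      | succ q ih => rw [pow_succ, chartEval_mul]; exact Kind.Good.mul ih hgood
    exact h1 p
  have hsub : faceOf ω.cone (s.1 + p • m + m) ≤ τ := by
    rw [e]
    intro v hv
    have h1 := hp v hv.1
    have h2 := hm v hv.1
    have h3 := (pairing_add_left _ m v).symm.trans hv.2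
    exact ⟨hv.1, by linarith⟩
  -- By minimality this face is all of `τ`. As `m` vanishes on `τ`, so does `s`, and then `-s` lies
  -- in `S_τ`.
  have hmin' := hmin ⟨_, hpm, hg, rfl⟩ hsub
  intro v hv
  rw [hdτ] at hv
  have h1 : v ∈ τ := e ▸ hv
  have h2 := (hmin' h1).2
  rw [pairing_add_left, pairing_add_left, pairing_nsmul_left, hv.2] at h2
  rw [pairing_neg_left]
  linarith

/-- A torus-invariant open subset that contains the center of a point contains a chart around
the center. -/
lemma IsTorusInvariant.exists_chart_le (hk : ∀ a : k, ¬ IsUnit a → ¬ κ.Good ‖a‖)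
    {U : (toricPrevariety k S).left.Opens} (hU : IsTorusInvariant U)
    (x : AnPoint κ (toricPrevariety k S)) (hxU : x.pt ∈ U) :
    ∃ ω : S.Omega, x.pt ∈ chart k S ω ''ᵁ ⊤ ∧ chart k S ω ''ᵁ ⊤ ≤ U := by
  obtain ⟨d, hd, h⟩ := exists_minimal_chart x
  obtain ⟨z, hz⟩ := mem_chart_iff.1 hd
  refine ⟨d, hd, ?_⟩
  rintro _ ⟨q, -, rfl⟩
  have hzU : z ∈ chart k S d ⁻¹ᵁ U := by
    change chart k S d z ∈ U
    rwa [hz]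
  refine mem_of_terms_mem (U := chart k S d ⁻¹ᵁ U) (fun P => ?_) hzU fun t c htc => ?_
  · exact SetLike.ext_iff.1 (hU d) P
  -- If a term `c χ^t` does not vanish at `z`, then `c` is a unit by `hk` and `χ^t` is invertible on
  -- the minimal chart. Such a term is a unit and cannot lie in the prime `q`.
  · by_contra hcon
    rw [single_eq_algebraMap_mul_chi] at hcon
    have h1 : algebraMap k _ c ∉ z.asIdeal := fun h => hcon (z.asIdeal.mul_mem_right _ h)
    have h2 : chi k t ∉ z.asIdeal := fun h => hcon (z.asIdeal.mul_mem_left _ h)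
    rw [← good_chartEval_iff x hd hz] at h1 h2
    rw [chartEval_algebraMap] at h1
    have hc : IsUnit c := not_not.1 fun h => hk c h h1
    refine q.2.ne_top (Ideal.eq_top_of_isUnit_mem _ htc ?_)
    obtain ⟨c', hc'⟩ := hc.exists_right_inv
    refine IsUnit.of_mul_eq_one (AddMonoidAlgebra.single ⟨-t.1, h t h2⟩ c') ?_
    rw [AddMonoidAlgebra.single_mul_single, hc', AddMonoidAlgebra.one_def]
    congr 1
    exact Subtype.ext (add_neg_cancel t.1)

end chart

/-! ### Characters as functions on the tropical space. -/

section value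

variable {κ : Kind} {S : SystemOfFans}

/-- The function `exp (-u(m))` on a union of charts on which the character `m` is regular. -/
lemma exists_coord_function (A : Set S.Omega) (m : Fin S.rank → ℤ)
    (hm : ∀ ω ∈ A, m ∈ dualMonoid ω.cone) :
    ∃ G : TropSpace κ S → ℝ,
      (∀ (ω : S.Omega) (hω : ω ∈ A) (u : TropChart κ ω.cone),
        G (TropSpace.mk ω u) = u.coord ⟨m, hm ω hω⟩) ∧
      ContinuousOn G (⋃ ω : A, Set.range (TropSpace.mk ω.1 : TropChart κ ω.1.cone → _)) := by
  classical
  let G : TropSpace κ S → ℝ := fun p =>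
    if h : ∃ (ω : A) (u : TropChart κ ω.1.cone), TropSpace.mk ω.1 u = p then
      h.choose_spec.choose.coord ⟨m, hm _ h.choose.2⟩ else 0
  have hG : ∀ (ω : S.Omega) (hω : ω ∈ A) (u : TropChart κ ω.cone),
      G (TropSpace.mk ω u) = u.coord ⟨m, hm ω hω⟩ := by
    intro ω hω u
    have h : ∃ (ω' : A) (u' : TropChart κ ω'.1.cone), TropSpace.mk ω'.1 u' = TropSpace.mk ω u :=
      ⟨⟨ω, hω⟩, u, rfl⟩
    change dite _ _ _ = _
    rw [dif_pos h]
    -- The chosen representative and `u` come from one point of a smaller chart, where the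
    -- coordinate at `m` is the same.
    obtain ⟨d, h1, h2, w, e1, e2⟩ := TropSpace.mk_eq_mk.1 h.choose_spec.choose_spec
    have e3 : h.choose_spec.choose.coord ⟨m, hm _ h.choose.2⟩ =
        (w.extend h1).coord ⟨m, hm _ h.choose.2⟩ := by rw [e1]
    exact e3.trans (congrArg (fun v : TropChart κ ω.cone => v.coord ⟨m, hm ω hω⟩) e2)
  refine ⟨G, hG, ?_⟩
  rw [continuousOn_iff_continuous_domRestrict]
  refine Kind.continuous_of_nice_cover κ (ι := A)
    (s := fun ω => Subtype.val ⁻¹' Set.range (TropSpace.mk ω.1 : TropChart κ ω.1.cone → _))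
    (fun ω => (TropSpace.nice_range_mk ω.1).preimage continuous_subtype_val)
    (fun x => by simpa using Set.mem_iUnion.1 x.2) fun ω => ?_
  -- On the range of one chart, `v` is the inverse of the chart embedding; it is continuous because
  -- that embedding is inducing.
  choose v hv using fun x : (Subtype.val ⁻¹'
    Set.range (TropSpace.mk ω.1 : TropChart κ ω.1.cone → _) : Set (⋃ ω : A,
      Set.range (TropSpace.mk ω.1 : TropChart κ ω.1.cone → _) : Set (TropSpace κ S))) => x.2
  have hcont : Continuous v := by
    rw [(TropSpace.isInducing_mk ω.1).continuous_iff]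
    have : TropSpace.mk ω.1 ∘ v = fun x => x.1.1 := funext hv
    rw [this]
    exact continuous_subtype_val.comp continuous_subtype_val
  refine ((TropChart.continuous_coord ⟨m, hm ω.1 ω.2⟩).comp hcont).congr fun x => ?_
  change _ = G x.1.1
  rw [← hv x, hG ω.1 ω.2]
  rfl

end value

/-! ### The limit of the tropicalizations. -/

namespace EmbeddingSystem

variable {κ : Kind} {k : Type u} [CommRing k] [Norm k] {Y : Over (Spec (CommRingCat.of k))}
  (𝓘 : EmbeddingSystem.{u, w} Y)

/-- Over the preimage of a chart, the coordinates of `trop_j` are absolute values of the pulled back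
characters, and these evaluations are continuous on principal opens. -/
lemma continuous_tropEmb (j : 𝓘.J) : Continuous (𝓘.tropEmb κ j) := by
  refine continuous_anPoint_of_basicOpen fun y => ?_
  obtain ⟨ω, hω⟩ := exists_mem_chart k (𝓘.emb j).S ((𝓘.emb j).map.left y)
  refine ⟨(𝓘.emb j).map.left ⁻¹ᵁ (chart k (𝓘.emb j).S ω ''ᵁ ⊤), hω, fun U f hf => ?_⟩
  have h : ∀ x : {x : AnOn κ Y U.1 // x.1.pt ∈ Y.left.basicOpen f},
      (x.1.1.map (𝓘.emb j).map).pt ∈ chart k (𝓘.emb j).S ω ''ᵁ ⊤ := fun x => hf x.2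
  have e : (fun x : {x : AnOn κ Y U.1 // x.1.pt ∈ Y.left.basicOpen f} => 𝓘.tropEmb κ j x.1.1) =
      TropSpace.mk ω ∘ fun x => tropChart (x.1.1.map (𝓘.emb j).map) ω (h x) :=
    funext fun x => trop_eq_mk _ (h x)
  rw [e]
  refine (TropSpace.continuous_mk ω).comp (TropChart.continuous_iff.2 fun s => ?_)
  simp only [tropChart_coord, chartEval_eq_eval_sec]
  refine (AnOn.continuous_eval_basicOpen U.2 f ((𝓘.emb j).map.left.appLE _ _ hf
    (sec (chart k (𝓘.emb j).S ω) (chi k s)))).congr fun x => ?_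
  exact (x.1.1.map_eval (𝓘.emb j).map hf x.2 _).symm

lemma tropMap_tropEmb {a b : 𝓘.J} {φ : ToricHom (𝓘.emb a).S (𝓘.emb b).S} (hφ : φ ∈ 𝓘.Mor a b)
    (y : AnPoint κ Y) : tropMap φ (𝓘.tropEmb κ a y) = 𝓘.tropEmb κ b y := by
  rw [tropEmb, tropMap_trop, AnPoint.map_map, 𝓘.comm a b φ hφ, tropEmb]

variable {𝓘}

/-- Iterated products give one index `c` whose coordinate determines those in `E` through toric
projections. Since `Trop(Y, c)` is an image, the coordinate of `x` at `c` is attained by some `y`.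
-/
lemma exists_tropEmb_eq (h0 : Nonempty 𝓘.J) (hprod : 𝓘.ClosedUnderProducts) (x : 𝓘.Lim κ)
    (E : Finset 𝓘.J) : ∃ y : AnPoint κ Y, ∀ j ∈ E, 𝓘.tropEmb κ j y = (x.1 j).1 := by
  classical
  obtain ⟨c, hc⟩ : ∃ c, ∀ y, 𝓘.tropEmb κ c y = (x.1 c).1 →
      ∀ j ∈ E, 𝓘.tropEmb κ j y = (x.1 j).1 := by
    induction E using Finset.induction_on with
    | empty => exact ⟨h0.some, fun _ _ j hj => absurd hj (Finset.notMem_empty j)⟩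
    | insert j E _ ih =>
      obtain ⟨c, hc⟩ := ih
      obtain ⟨d, p, hp, q, hq, -⟩ := hprod c j
      refine ⟨d, fun y hy i hi => ?_⟩
      rcases Finset.mem_insert.1 hi with rfl | hi
      · rw [← 𝓘.tropMap_tropEmb hq, hy, x.2 d i q hq]
      · exact hc y (by rw [← 𝓘.tropMap_tropEmb hp, hy, x.2 d c p hp]) i hi
  obtain ⟨y, hy⟩ := (x.1 c).2
  exact ⟨y, hc y hy⟩

/-- A regular function that is the pullback of a monomial on a torus-invariant open subset has
an absolute value that is a continuous function of the tropicalization. -/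
lemma exists_eval_eq_tropEmb (hk : ∀ a : k, ¬ IsUnit a → ¬ κ.Good ‖a‖) {V : Y.left.Opens}
    {f : Γ(Y.left, V)} {j : 𝓘.J} {U : (toricPrevariety k (𝓘.emb j).S).left.Opens}
    {g : Γ((toricPrevariety k (𝓘.emb j).S).left, U)} (hU : IsTorusInvariant U)
    (hg : IsMonomial g) (h : V = (𝓘.emb j).map.left ⁻¹ᵁ U)
    (hf : (𝓘.emb j).map.left.appLE U V h.le g = f) :
    ∃ (T : Set (TropSpace κ (𝓘.emb j).S)) (G : TropSpace κ (𝓘.emb j).S → ℝ), κ.Nice T ∧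
      ContinuousOn G T ∧ (∀ y : AnPoint κ Y, 𝓘.tropEmb κ j y ∈ T ↔ y.pt ∈ V) ∧
      ∀ (y : AnPoint κ Y) (hy : y.pt ∈ V), y.eval V hy f = G (𝓘.tropEmb κ j y) := by
  obtain ⟨a, m, ham⟩ := hg.eval_eq (κ := κ)
  let A : Set (𝓘.emb j).S.Omega := {ω | chart k (𝓘.emb j).S ω ''ᵁ ⊤ ≤ U}
  choose hm heval using ham
  obtain ⟨G, hG, hGc⟩ := exists_coord_function (κ := κ) A m hm
  have hmem : ∀ y : AnPoint κ Y, y.pt ∈ V → ∃ ω ∈ A,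
      (y.map (𝓘.emb j).map).pt ∈ chart k (𝓘.emb j).S ω ''ᵁ ⊤ := by
    intro y hy
    rw [h] at hy
    obtain ⟨ω, h1, h2⟩ := hU.exists_chart_le hk (y.map (𝓘.emb j).map) hy
    exact ⟨ω, h2, h1⟩
  -- The set `T` is the union of the tropical charts contained in `U`. By torus-invariance these
  -- contain every center in `U`, so `T` detects `V`.
  refine ⟨_, fun p => ‖a‖ * G p, κ.nice_iUnion fun ω : A => TropSpace.nice_range_mk ω.1,
    continuousOn_const.mul hGc, fun y => ?_, fun y hy => ?_⟩
  · rw [Set.mem_iUnion]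
    constructor
    · rintro ⟨ω, hω⟩
      rw [h]
      exact ω.2 (trop_mem_range_mk.1 hω)
    · intro hy
      obtain ⟨ω, h1, h2⟩ := hmem y hy
      exact ⟨⟨ω, h1⟩, trop_mem_range_mk.2 h2⟩
  · obtain ⟨ω, h1, h2⟩ := hmem y hy
    have hyU : (y.map (𝓘.emb j).map).pt ∈ U := h1 h2
    change _ = ‖a‖ * G (trop (y.map (𝓘.emb j).map))
    rw [trop_eq_mk _ h2, hG ω h1, ← heval ω h1 (y.map (𝓘.emb j).map) hyU h2,
      y.map_eval (𝓘.emb j).map h.le hy, hf]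

variable (𝓘) in
/-- The tropicalization of a point is determined by approximations with the same values on
finitely many functions. -/
lemma tropEmb_eq_of_approx {V : Y.left.Opens} (hV : IsAffineOpen V) {y : AnPoint κ Y}
    (hy : y.pt ∈ V) (j : 𝓘.J) (t : TropSpace κ (𝓘.emb j).S)
    (h : ∀ F : Finset Γ(Y.left, V), ∃ (y' : AnPoint κ Y) (hy' : y'.pt ∈ V),
      (∀ f ∈ F, y'.eval V hy' f = y.eval V hy f) ∧ 𝓘.tropEmb κ j y' = t) :
    𝓘.tropEmb κ j y = t := by
  classical
  obtain ⟨ω, hω⟩ := exists_mem_chart k (𝓘.emb j).S ((𝓘.emb j).map.left y.pt)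
  obtain ⟨f, hf, hyf⟩ := hV.exists_basicOpen_le
    (V := (𝓘.emb j).map.left ⁻¹ᵁ (chart k (𝓘.emb j).S ω ''ᵁ ⊤)) ⟨y.pt, hω⟩ hy
  -- Agreement at the single function `f` already moves the center of `y'` into `D(f)`, and thus
  -- into the chart `ω`.
  have hgood : ∀ (y' : AnPoint κ Y) (hy' : y'.pt ∈ V), y'.eval V hy' f = y.eval V hy f →
      y'.pt ∈ Y.left.basicOpen f := by
    intro y' hy' e
    rw [← y'.good_eval_iff hy', e, y.good_eval_iff hy]
    exact hyf
  obtain ⟨u, rfl⟩ : ∃ u, TropSpace.mk ω u = t := by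
    obtain ⟨y', hy', h1, rfl⟩ := h {f}
    exact ⟨_, (trop_eq_mk (y'.map (𝓘.emb j).map) (hf (hgood y' hy' (h1 f (by simp))))).symm⟩
  refine (trop_eq_mk (y.map (𝓘.emb j).map) hω).trans
    (congrArg _ (TropChart.ext_coord fun s => ?_))
  obtain ⟨n, a, ha⟩ := AnPoint.exists_eval_basicOpen_eq (κ := κ) hV f
    ((𝓘.emb j).map.left.appLE _ _ hf (sec (chart k (𝓘.emb j).S ω) (chi k s)))
  have hcoord : ∀ (z : AnPoint κ Y) (hz : z.pt ∈ Y.left.basicOpen f),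
      (tropChart (z.map (𝓘.emb j).map) ω (hf hz)).coord s =
        z.eval V (Y.left.basicOpen_le f hz) a / z.eval V (Y.left.basicOpen_le f hz) f ^ n := by
    intro z hz
    rw [← ha z hz]
    exact (tropChart_coord (z.map (𝓘.emb j).map) (hf hz) s).trans
      (z.map_eval (𝓘.emb j).map hf hz _)
  obtain ⟨y', hy', h1, h2⟩ := h {f, a}
  -- The coordinate at `s` is `|a| / |f| ^ n`, so agreement on `f` and `a` suffices; `u` does not
  -- depend on `y'`.
  have hf' := hgood y' hy' (h1 f (by simp))
  have e : tropChart (y'.map (𝓘.emb j).map) ω (hf hf') = u :=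
    TropSpace.mk_injective ω ((trop_eq_mk (y'.map (𝓘.emb j).map) (hf hf')).symm.trans h2)
  rw [← e, hcoord y hyf, hcoord y' hf', h1 f (by simp), h1 a (by simp)]

/-- The limit theorem over a base in which non-units have small absolute value. -/
theorem exists_homeomorph (hk : ∀ a : k, ¬ IsUnit a → ¬ κ.Good ‖a‖) (h0 : Nonempty 𝓘.J)
    (hprod : 𝓘.ClosedUnderProducts) (hstar : 𝓘.PropertyStar) :
    ∃ π : AnPoint κ Y ≃ₜ 𝓘.Lim κ,
      ∀ (y : AnPoint κ Y) (j : 𝓘.J), ((π y).1 j).1 = 𝓘.tropEmb κ j y := by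
  classical
  obtain ⟨r, V, hV, hcov, hst⟩ := hstar
  have hst' : ∀ l (f : Γ(Y.left, V l)), ∃ (j : 𝓘.J) (T : Set (TropSpace κ (𝓘.emb j).S))
      (G : TropSpace κ (𝓘.emb j).S → ℝ), κ.Nice T ∧
      ContinuousOn G T ∧ (∀ y : AnPoint κ Y, 𝓘.tropEmb κ j y ∈ T ↔ y.pt ∈ V l) ∧
      ∀ (y : AnPoint κ Y) (hy : y.pt ∈ V l), y.eval (V l) hy f = G (𝓘.tropEmb κ j y) := by
    intro l f
    obtain ⟨j, U, g, hU, hg, h, hf⟩ := hst l f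
    exact ⟨j, exists_eval_eq_tropEmb hk hU hg h hf⟩
  choose J T G hT hG hmem heval using hst'
  have hcov' : ∀ y : Y.left, ∃ l, y ∈ V l := fun y => by
    have : y ∈ ⨆ l, V l := by rw [hcov]; trivial
    exact TopologicalSpace.Opens.mem_iSup.1 this
  let π : AnPoint κ Y → 𝓘.Lim κ := fun y =>
    ⟨fun j => ⟨𝓘.tropEmb κ j y, y, rfl⟩, fun a b φ hφ => 𝓘.tropMap_tropEmb hφ y⟩
  have hπ : Continuous π := by
    refine Continuous.subtype_mk (continuous_pi fun j => ?_) _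
    exact (𝓘.continuous_tropEmb j).subtype_mk _
  have hinj : Function.Injective π := by
    intro y y' h
    have h1 : ∀ j, 𝓘.tropEmb κ j y = 𝓘.tropEmb κ j y' := fun j =>
      congrArg (fun x : 𝓘.Lim κ => (x.1 j).1) h
    obtain ⟨l, hl⟩ := hcov' y.pt
    have hl' : y'.pt ∈ V l := by rwa [← hmem l 0, ← h1, hmem]
    refine AnPoint.ext_of_eval (hV l) hl hl' fun f => ?_
    rw [heval, heval, h1]
  -- All indices `J l f` detect `V_l` alike, since for an actual point each condition says that the
  -- center lies in `V_l`. The function `0` merely supplies a reference index.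
  have hmemx : ∀ (x : 𝓘.Lim κ) l f, (x.1 (J l f)).1 ∈ T l f ↔ (x.1 (J l 0)).1 ∈ T l 0 := by
    intro x l f
    obtain ⟨y, hy⟩ := exists_tropEmb_eq h0 hprod x {J l f, J l 0}
    rw [← hy _ (by simp), ← hy (J l 0) (by simp), hmem, hmem]
  have hcovx : ∀ x : 𝓘.Lim κ, ∃ l, (x.1 (J l 0)).1 ∈ T l 0 := by
    intro x
    obtain ⟨y, hy⟩ := exists_tropEmb_eq h0 hprod x (Finset.univ.image fun l => J l 0)
    obtain ⟨l, hl⟩ := hcov' y.pt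
    exact ⟨l, by rwa [← hy _ (Finset.mem_image_of_mem _ (Finset.mem_univ l)), hmem]⟩
  have hsurj : Function.Surjective π := by
    intro x
    obtain ⟨l, hl⟩ := hcovx x
    have happrox : ∀ (F : Finset Γ(Y.left, V l)) (j : 𝓘.J), ∃ (y : AnPoint κ Y) (hy : y.pt ∈ V l),
        (∀ f ∈ F, y.eval (V l) hy f = G l f (x.1 (J l f)).1) ∧ 𝓘.tropEmb κ j y = (x.1 j).1 := by
      intro F j
      obtain ⟨y, hy⟩ := exists_tropEmb_eq h0 hprod x
        (insert j (insert (J l 0) (F.image (J l))))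
      have hyl : y.pt ∈ V l := by rwa [← hmem l 0, hy _ (by simp)]
      refine ⟨y, hyl, fun f hf => ?_, hy _ (by simp)⟩
      rw [heval, hy _ (Finset.mem_insert_of_mem (Finset.mem_insert_of_mem
        (Finset.mem_image_of_mem _ hf)))]
    have hval : ∀ F : Finset Γ(Y.left, V l), ∃ (y : AnPoint κ Y) (hy : y.pt ∈ V l),
        ∀ f ∈ F, G l f (x.1 (J l f)).1 = y.evalSeminorm hy f := fun F => by
      obtain ⟨y, hy, h, -⟩ := happrox F h0.some
      exact ⟨y, hy, fun f hf => (h f hf).symm⟩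
    -- Each axiom concerns at most three functions, so it can be read off at one actual point of `Y`
    -- having the prescribed values.
    let p : MulRingSeminorm Γ(Y.left, V l) :=
      { toFun := fun f => G l f (x.1 (J l f)).1
        map_zero' := by
          obtain ⟨y, hy, h⟩ := hval {0}
          rw [h 0 (by simp), map_zero]
        map_one' := by
          obtain ⟨y, hy, h⟩ := hval {1}
          rw [h 1 (by simp), map_one]
        add_le' := fun f g => by
          obtain ⟨y, hy, h⟩ := hval {f, g, f + g}
          rw [h f (by simp), h g (by simp), h (f + g) (by simp)]
          exact map_add_le_add _ f g
        neg' := fun f => by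
          obtain ⟨y, hy, h⟩ := hval {f, -f}
          rw [h f (by simp), h (-f) (by simp), map_neg_eq_map]
        map_mul' := fun f g => by
          obtain ⟨y, hy, h⟩ := hval {f, g, f * g}
          rw [h f (by simp), h g (by simp), h (f * g) (by simp), map_mul] }
    obtain ⟨y, hy, hyp⟩ := AnPoint.exists_of_seminorm (κ := κ) (hV l) p
      (fun a => by
        obtain ⟨y, hy, h⟩ := hval {AnPoint.const Y (V l) a}
        exact (h _ (by simp)).trans (y.eval_const hy a))
      (fun hκ f => by
        obtain ⟨y, hy, h⟩ := hval {f}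
        refine (h _ (by simp)).trans_le ?_
        subst hκ
        exact (y.center _).1)
    refine ⟨y, Subtype.ext (funext fun j => Subtype.ext ?_)⟩
    exact tropEmb_eq_of_approx 𝓘 (hV l) hy j (x.1 j).1 fun F => by
      obtain ⟨y', hy', h1, h2⟩ := happrox F j
      exact ⟨y', hy', fun f hf => (h1 f hf).trans (hyp f).symm, h2⟩
  let e : AnPoint κ Y ≃ 𝓘.Lim κ := Equiv.ofBijective π ⟨hinj, hsurj⟩
  have he : ∀ x j, 𝓘.tropEmb κ j (e.symm x) = (x.1 j).1 := fun x j =>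
    congrArg (fun x : 𝓘.Lim κ => (x.1 j).1) (e.apply_symm_apply x)
  have hproj : ∀ j, Continuous fun x : 𝓘.Lim κ => (x.1 j).1 := fun j =>
    continuous_subtype_val.comp ((continuous_apply j).comp continuous_subtype_val)
  refine ⟨⟨e, hπ, ?_⟩, fun y j => rfl⟩
  -- The pieces of the limit corresponding to the `V_l`. On each, the inverse lands in `V_l^an`
  -- (resp. `V_l^∘`), whose topology is tested by the functions `G l f` of the coordinates.
  refine Kind.continuous_of_nice_cover κ (s := fun l => {x : 𝓘.Lim κ | (x.1 (J l 0)).1 ∈ T l 0})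
    (fun l => (hT l 0).preimage (hproj _)) hcovx fun l => ?_
  have hpt : ∀ x : {x : 𝓘.Lim κ | (x.1 (J l 0)).1 ∈ T l 0}, (e.symm x.1).pt ∈ V l := fun x => by
    rw [← hmem l 0, he]; exact x.2
  let ρ : {x : 𝓘.Lim κ | (x.1 (J l 0)).1 ∈ T l 0} → AnOn κ Y (V l) := fun x =>
    ⟨e.symm x.1, hpt x⟩
  have hρ : Continuous ρ := by
    refine AnOn.continuous_iff.2 fun f => ?_
    change Continuous fun x : {x : 𝓘.Lim κ | (x.1 (J l 0)).1 ∈ T l 0} =>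
      (e.symm x.1).eval (V l) (hpt x) f
    simp only [heval, he]
    exact (hG l f).comp_continuous ((hproj _).comp continuous_subtype_val)
      fun x => (hmemx x.1 l f).2 x.2
  exact (AnOn.continuous_val (hV l)).comp hρ

end EmbeddingSystem
end ToricTrop

/-! ### The two base rings `K` and `R`. -/

theorem mainTheorem2 {K : Type u} [NormedField K] [IsUltrametricDist K] [CompleteSpace K] :
    (∀ (Y : Over (Spec (CommRingCat.of K))),
      LocallyOfFiniteType Y.hom → QuasiCompact Y.hom →
      ∀ 𝓘 : ToricTrop.EmbeddingSystem.{u, w} Y, Nonempty 𝓘.J →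
        𝓘.ClosedUnderProducts → 𝓘.PropertyPlus → 𝓘.PropertyStar →
        ∃ π : ToricTrop.AnPoint .full Y ≃ₜ 𝓘.Lim .full,
          ∀ (y : ToricTrop.AnPoint .full Y) (j : 𝓘.J),
            ((π y).1 j).1 = 𝓘.tropEmb .full j y) ∧
    (∀ (Y : Over (Spec (CommRingCat.of (NormedField.valuation (K := K)).integer))),
      LocallyOfFiniteType Y.hom → QuasiCompact Y.hom →
      ∀ 𝓘 : ToricTrop.EmbeddingSystem.{u, w} Y, Nonempty 𝓘.J →
        𝓘.ClosedUnderProducts → 𝓘.PropertyPlus → 𝓘.PropertyStar →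
        ∃ π : ToricTrop.AnPoint .nonneg Y ≃ₜ 𝓘.Lim .nonneg,
          ∀ (y : ToricTrop.AnPoint .nonneg Y) (j : 𝓘.J),
            ((π y).1 j).1 = 𝓘.tropEmb .nonneg j y) := by
  refine ⟨fun Y _ _ 𝓘 h0 hprod _ hstar => ?_, fun Y _ _ 𝓘 h0 hprod _ hstar => ?_⟩
  · refine ToricTrop.EmbeddingSystem.exists_homeomorph (fun a ha h => ha ?_) h0 hprod hstar
    exact isUnit_iff_ne_zero.2 (norm_ne_zero_iff.1 h)
  · refine ToricTrop.EmbeddingSystem.exists_homeomorph (fun a ha h => ha ?_) h0 hprod hstar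
    have h1 : 1 ≤ ‖(a : K)‖ := h
    have h0 : (a : K) ≠ 0 := norm_pos_iff.1 (zero_lt_one.trans_le h1)
    -- An element of `R` of norm at least `1` is a unit of `R`, as its inverse has norm at most `1`.
    have h2 : (a : K)⁻¹ ∈ (NormedField.valuation (K := K)).integer := by
      rw [Valuation.mem_integer_iff, NormedField.valuation_apply, ← NNReal.coe_le_coe, coe_nnnorm,
        norm_inv]
      exact inv_le_one_of_one_le₀ h1
    exact IsUnit.of_mul_eq_one ⟨_, h2⟩ (Subtype.ext (mul_inv_cancel₀ h0))
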